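/- **Setting.** Let $d<n$ and write $\mathbb T^d=\mathbb R^d/(2\pi\mathbb Z)^d$. Let $U\subset\mathbb R^{2n}$ be open, with an exact symplectic form given by the matrix $\Omega=(\mathrm Da)^\top-\mathrm Da$, where $a:U\to\mathbb R^{2n}$ is real analytic and $\det\Omega(z)\neq0$ on $U$. Let $h_\lambda:U\to\mathbb R$ be Hamiltonians with parameter $\lambda\in V$, $V\subset\mathbb R^{n-d}$ open, such that $(z,\lambda)\mapsto h_\lambda(z)$ is real analytic, and let $X_h(z;\lambda)=\Omega(z)^{-1}(\mathrm D_zh_\lambda(z))^\top$. Let $(\omega,\beta)\in\mathbb R^d\times\mathbb R^{n-d}$ satisfy the Diophantine–Melnikov conditions of type $(\gamma,\tau)$, $\gamma>0$, $\tau>d-1$: $\beta_i\ne0$ for all $i$, $|\beta_i|\neq|\beta_j|$ for $i\ne j$, and for all $k\in\mathbb Z^d\setminus\{0\}$: $|k\cdot\omega|\ge\gamma|k|_1^{-\tau}$; $|k\cdot\omega-\beta_i|\ge\gamma|k|_1^{-\tau}$ for all $i$; $|k\cdot\omega-\beta_i\pm\beta_j|\ge\gamma|k|_1^{-\tau}$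 for all $i\neq j$. For $u$ on $\mathbb T^d$ put $\mathfrak L_\omega u=-\mathrm Du\cdot\omega$ (componentwise), and for $\alpha\in\mathbb R^{n-d}$ put $$\Gamma_{\alpha,\beta}=\begin{pmatrix}\operatorname{diag}(\alpha)&-\operatorname{diag}(\beta)\\ \operatorname{diag}(\beta)&\operatorname{diag}(\alpha)\end{pmatrix}.$$ For $K:\mathbb T^d\to U$, $W:\mathbb T^d\to\mathbb R^{2n\times2(n-d)}$, $\lambda\in V$ and $\alpha\in\mathbb R^{n-d}$, the invariance errors are $$E_K=\mathfrak L_\omega K+X_h(K;\lambda),\qquad E_W=\mathfrak L_\omega W+\mathrm D_zX_h(K;\lambda)\,W-W\,\Gamma_{\alpha,\beta},$$ and $\Omega_{WW}=W^\top(\Omega\circ K)W$. For $\rho>0$, $\|f\|_\rho$ denotes the supremum over the strip $\{z\in\mathbb C^d:|\operatorname{Im}z_j|<\rho\}$ of the holomorphic extension of $f$ ($\max_i|f_i|$ for vectors, $\max_i\sum_j|f_{ij}|$ for matrices), with $\|f\|_\rho=\infty$ if there is no bounded extension; $\|\alpha\|=\max_i|\alpha_i|$. **Lemma.** The dummy parameter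 $\alpha$ is $\mathcal O(E_K,E_W)$, and it is zero if $K$ and $W$ are invariant. Precisely: 1. For all compact sets $\mathcal K\subset U$, $\Lambda\subset V$ and all $\rho>0$, $R\ge 0$, $c>0$ there is a constant $C$ such that every $(K,W,\lambda,\alpha)$ with $K(\mathbb T^d)\subset\mathcal K$, $\lambda\in\Lambda$, $\|K\|_\rho\le R$, $\|W\|_\rho\le R$ and $|\det\Omega_{WW}(\theta)|\ge c$ for all $\theta$ satisfies, for every $\delta>0$, $$\|\alpha\|\le C\,\big(\|E_K\|_\delta+\|E_W\|_\delta\big).$$ 2. If $K:\mathbb T^d\to U$ and $W$ have finite norm $\|\cdot\|_\rho$ for some $\rho>0$, $\lambda\in V$, $\det\Omega_{WW}(\theta)\ne0$ for all $\theta$, and $E_K=0$, $E_W=0$, then $\alpha=0$. -/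

import Mathlib

open scoped NNReal ENNReal

noncomputable section

namespace LowDimTori

/-! ### Maps on the torus

Maps on `𝕋ᵈ = ℝᵈ / (2πℤ)ᵈ` are maps on `ℝᵈ` that are `2π`-periodic in every variable. -/

/-- `f` is `2π`-periodic in each of its `d` variables, i.e. it is a map on the torus. -/
def TorusPeriodic {d : ℕ} {E : Type*} (f : (Fin d → ℝ) → E) : Prop :=
  ∀ (θ : Fin d → ℝ) (k : Fin d → ℤ), f (fun j => θ j + 2 * Real.pi * (k j : ℝ)) = f θ

/-- The complex strip `{z ∈ ℂᵈ : |Im z_j| < ρ for all j}`. -/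
def strip (d : ℕ) (ρ : ℝ) : Set (Fin d → ℂ) :=
  {z | ∀ j, |(z j).im| < ρ}

/-- `F` is a (componentwise) holomorphic extension to the strip of width `ρ` of the real
matrix-valued map `f`. -/
def IsStripExtension {d : ℕ} {ι κ : Type*} (ρ : ℝ)
    (f : (Fin d → ℝ) → Matrix ι κ ℝ) (F : (Fin d → ℂ) → Matrix ι κ ℂ) : Prop :=
  (∀ i j, DifferentiableOn ℂ (fun z => F z i j) (strip d ρ)) ∧
    ∀ (θ : Fin d → ℝ) (i : ι) (j : κ), F (fun l => (θ l : ℂ)) i j = (f θ i j : ℂ)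

/-- The norm of `f` in the Banach space of analytic maps on the strip of width `ρ`: the supremum
over the strip of the maximal row sum `max_i ∑_j |F_{ij}(z)|` of the holomorphic extension `F`
of `f`. It is `∞` when `f` has no (bounded) holomorphic extension to the strip. The extension is
unique on the strip when it exists, so that the infimum is over at most one value. -/
def stripNorm {d : ℕ} {ι κ : Type*} [Fintype κ] (ρ : ℝ)
    (f : (Fin d → ℝ) → Matrix ι κ ℝ) : ℝ≥0∞ :=
  ⨅ (F : (Fin d → ℂ) → Matrix ι κ ℂ) (_ : IsStripExtension ρ f F),
    ⨆ z ∈ strip d ρ, ⨆ i, ∑ j, ‖F z i j‖ₑ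

/-- The same norm for vector-valued maps (matrices with one column): the supremum over the strip
of `max_i |F_i(z)|`. -/
def stripNormVec {d : ℕ} {ι : Type*} (ρ : ℝ) (f : (Fin d → ℝ) → ι → ℝ) : ℝ≥0∞ :=
  stripNorm ρ (fun θ => Matrix.replicateCol Unit (f θ))

/-- The Lie derivative of a function on the torus in the direction `ω`:
`𝔏_ω u = - Du · ω`. -/
def lieDeriv {d : ℕ} (ω : Fin d → ℝ) (u : (Fin d → ℝ) → ℝ) (θ : Fin d → ℝ) : ℝ :=
  -(fderiv ℝ u θ ω)

/-! ### Symplectic setting -/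

/-- The matrix of partial derivatives, `(Df)_{rs} = ∂f_r / ∂z_s`. -/
def jacobian {N : ℕ} (f : (Fin N → ℝ) → (Fin N → ℝ)) (z : Fin N → ℝ) :
    Matrix (Fin N) (Fin N) ℝ :=
  Matrix.of fun r s => fderiv ℝ (fun y => f y r) z (Pi.single s 1)

/-- The vector of partial derivatives, `(∇f)_s = ∂f / ∂z_s`. -/
def grad {N : ℕ} (f : (Fin N → ℝ) → ℝ) (z : Fin N → ℝ) : Fin N → ℝ :=
  fun s => fderiv ℝ f z (Pi.single s 1)

/-- The matrix `Ω = (Da)ᵀ - Da` of the exact 2-form `d(∑ a_i dz_i)`. -/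
def sympMatrix {N : ℕ} (a : (Fin N → ℝ) → (Fin N → ℝ)) (z : Fin N → ℝ) :
    Matrix (Fin N) (Fin N) ℝ :=
  (jacobian a z).transpose - jacobian a z

/-- The Hamiltonian vector field `X_h = Ω⁻¹ (Dh)ᵀ`. -/
def hamField {N : ℕ} (a : (Fin N → ℝ) → (Fin N → ℝ)) (h : (Fin N → ℝ) → ℝ)
    (z : Fin N → ℝ) : Fin N → ℝ :=
  (sympMatrix a z)⁻¹.mulVec (grad h z)

/-! ### Invariance equations -/

/-- The matrix `Γ_{α,β}` with blocks `diag α`, `-diag β`, `diag β`, `diag α`. -/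
def Gam {m : ℕ} (α β : Fin m → ℝ) : Matrix (Fin m ⊕ Fin m) (Fin m ⊕ Fin m) ℝ :=
  Matrix.fromBlocks (Matrix.diagonal α) (-Matrix.diagonal β)
    (Matrix.diagonal β) (Matrix.diagonal α)

/-- The error `E_K = 𝔏_ω K + X_h ∘ K` of the invariance equation of the torus. -/
def errK {d N : ℕ} (a : (Fin N → ℝ) → (Fin N → ℝ)) (h : (Fin N → ℝ) → ℝ)
    (ω : Fin d → ℝ) (K : (Fin d → ℝ) → Fin N → ℝ) (θ : Fin d → ℝ) : Fin N → ℝ :=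
  fun r => lieDeriv ω (fun t => K t r) θ + hamField a h (K θ) r

/-- The error `E_W = 𝔏_ω W + (DX_h ∘ K) W - W Γ_{α,β}` of the invariance equation of the
normal bundle. -/
def errW {d N m : ℕ} (a : (Fin N → ℝ) → (Fin N → ℝ)) (h : (Fin N → ℝ) → ℝ)
    (ω : Fin d → ℝ) (α β : Fin m → ℝ) (K : (Fin d → ℝ) → Fin N → ℝ)
    (W : (Fin d → ℝ) → Matrix (Fin N) (Fin m ⊕ Fin m) ℝ) (θ : Fin d → ℝ) :
    Matrix (Fin N) (Fin m ⊕ Fin m) ℝ :=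
  (Matrix.of fun r s => lieDeriv ω (fun t => W t r s) θ)
    + jacobian (hamField a h) (K θ) * W θ - W θ * Gam α β

/-- `Ω_{WW} = Wᵀ (Ω ∘ K) W`. -/
def omegaWW {d N m : ℕ} (a : (Fin N → ℝ) → (Fin N → ℝ)) (K : (Fin d → ℝ) → Fin N → ℝ)
    (W : (Fin d → ℝ) → Matrix (Fin N) (Fin m ⊕ Fin m) ℝ) (θ : Fin d → ℝ) :
    Matrix (Fin m ⊕ Fin m) (Fin m ⊕ Fin m) ℝ :=
  (W θ).transpose * sympMatrix a (K θ) * W θ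

/-- Diophantine-Melnikov conditions of type `(γ, τ)` on `(ω, β)`; here `|k|₁ = ∑ |k_l|`. -/
structure DiophantineMelnikov {d m : ℕ} (ω : Fin d → ℝ) (β : Fin m → ℝ) (γ τ : ℝ) : Prop where
  gamma_pos : 0 < γ
  tau_gt : (d : ℝ) - 1 < τ
  beta_ne_zero : ∀ i, β i ≠ 0
  beta_abs_ne : ∀ i j, i ≠ j → |β i| ≠ |β j|
  diophantine : ∀ k : Fin d → ℤ, k ≠ 0 →
    γ / (∑ l, |(k l : ℝ)|) ^ τ ≤ |∑ l, (k l : ℝ) * ω l|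
  melnikov_one : ∀ k : Fin d → ℤ, k ≠ 0 → ∀ i,
    γ / (∑ l, |(k l : ℝ)|) ^ τ ≤ |∑ l, (k l : ℝ) * ω l - β i|
  melnikov_two : ∀ k : Fin d → ℤ, k ≠ 0 → ∀ i j, i ≠ j →
    γ / (∑ l, |(k l : ℝ)|) ^ τ ≤ |∑ l, (k l : ℝ) * ω l - β i + β j| ∧
    γ / (∑ l, |(k l : ℝ)|) ^ τ ≤ |∑ l, (k l : ℝ) * ω l - β i - β j|

end LowDimTori

end

open LowDimTori

/-!
Write `Γ = Γ_{α,β}` and `∂_ω` for the derivative along the flow of `ω`. Since the Hamiltonian field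
preserves the closed form `Ω` (`lieDerivative_sympMatrix`), the antisymmetric matrix `Ω_WW`
satisfies `∂_ω Ω_WW + Γᵀ Ω_WW + Ω_WW Γ = -S`, where `S` is linear in the invariance errors
(`hasDerivAt_omegaWW`). In the complex eigenbasis of `Γ`, which does not depend on `α` and `β`,
this system decouples: the Fourier coefficient of index `k` of the entry `(p, q)` is multiplied by
`i k·ω + μ_p + μ_q`, where `μ = α ± iβ` are the eigenvalues (`norm_mul_torusCoeff_le`).

In the row of the eigenvector of `α_j + i β_j`, the diagonal entry vanishes by antisymmetry, and
the Melnikov conditions make the imaginary part of `i k·ω + μ_p + μ_q` nonzero for all other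
entries and all `k`, with one exception: the mean value of the pairing with the conjugate
eigenvector, whose factor is `2 α_j`. Since `det Ω_WW ≠ 0`, the row does not vanish, so one of its
Fourier coefficients is nonzero. If all errors are zero, it can only be the exceptional one, and
`α_j = 0`.

The uniform version is a compactness argument. The norms on the strip bound `K` and `W` in the
Lipschitz norm of the torus (`lipschitz_of_stripNorm_le`, by the Schwarz lemma), so that the
matrices `Ω_WW` lie in a compact set of continuous functions, on which the determinant stays away
from zero. Hence some Fourier coefficient of the row, weighted with its frequency, exceeds a
constant `κ > 0` (`exists_lt_torusCoeff_of_boundedPair`). If it is the exceptional one, then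
`2 κ |α_j|` is bounded by the errors. Otherwise the errors are not small, and the a priori
bound `|α_j| ≤ C (1 + ‖E_W‖)`, from solving the equation of `W` for `Γ`
(`exists_abs_alpha_le`), is enough. No loss of the strip width occurs, because only sup norms of
the errors on the real torus enter.
-/

/-! ### Analyticity and the invariance of `Ω` under the Hamiltonian field -/

theorem AnalyticAt.matrix_det {E : Type*} [NormedAddCommGroup E] [NormedSpace ℝ E]
    {ι : Type*} [Fintype ι] [DecidableEq ι] {M : E → Matrix ι ι ℝ} {z : E}
    (hM : ∀ i j, AnalyticAt ℝ (fun y => M y i j) z) : AnalyticAt ℝ (fun y => (M y).det) z := by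
  simp only [Matrix.det_apply']
  refine Finset.analyticAt_fun_sum _ fun σ _ => ?_
  exact analyticAt_const.mul (Finset.analyticAt_fun_prod _ fun i _ => hM _ _)

theorem AnalyticAt.matrix_inv {E : Type*} [NormedAddCommGroup E] [NormedSpace ℝ E]
    {ι : Type*} [Fintype ι] [DecidableEq ι] {M : E → Matrix ι ι ℝ} {z : E}
    (hM : ∀ i j, AnalyticAt ℝ (fun y => M y i j) z) (hz : (M z).det ≠ 0) (i j : ι) :
    AnalyticAt ℝ (fun y => (M y)⁻¹ i j) z := by
  simp only [Matrix.inv_def, Matrix.smul_apply, Ring.inverse_eq_inv', smul_eq_mul,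
    Matrix.adjugate_apply]
  refine ((AnalyticAt.matrix_det hM).inv hz).mul (AnalyticAt.matrix_det fun r s => ?_)
  by_cases h : r = j
  · subst h; simpa using analyticAt_const
  · simpa [Matrix.updateRow_ne h] using hM r s

theorem AnalyticAt.fderiv_apply_const {E : Type*} [NormedAddCommGroup E] [NormedSpace ℝ E]
    {f : E → ℝ} {z : E} (hf : AnalyticAt ℝ f z) (v : E) :
    AnalyticAt ℝ (fun y => fderiv ℝ f y v) z :=
  ((ContinuousLinearMap.apply ℝ ℝ v).analyticAt _).comp hf.fderiv

/-- Partial derivatives of a jointly analytic function in its first variable are jointly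
analytic. -/
theorem AnalyticAt.fderiv_fst_apply {E F : Type*} [NormedAddCommGroup E] [NormedSpace ℝ E]
    [NormedAddCommGroup F] [NormedSpace ℝ F]
    {g : E × F → ℝ} {p : E × F} (hg : AnalyticAt ℝ g p) (v : E) :
    AnalyticAt ℝ (fun q : E × F => fderiv ℝ (fun y => g (y, q.2)) q.1 v) p := by
  refine (hg.fderiv_apply_const (v, 0)).congr ?_
  filter_upwards [hg.eventually_analyticAt] with q hq
  have h1 : HasFDerivAt (fun y : E => (y, q.2)) (ContinuousLinearMap.inl ℝ E F) q.1 :=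
    hasFDerivAt_prodMk_left q.1 q.2
  have h2 := (hq.differentiableAt.hasFDerivAt (x := (q.1, q.2))).comp q.1 h1
  have h3 : fderiv ℝ (fun y => g (y, q.2)) q.1 = _ := h2.fderiv
  rw [h3]; simp

theorem AnalyticAt.fderiv_fderiv_comm {E : Type*} [NormedAddCommGroup E] [NormedSpace ℝ E]
    {f : E → ℝ} {z : E} (hf : AnalyticAt ℝ f z) (u v : E) :
    fderiv ℝ (fun y => fderiv ℝ f y u) z v = fderiv ℝ (fun y => fderiv ℝ f y v) z u := by
  have hd : DifferentiableAt ℝ (fderiv ℝ f) z := hf.fderiv.differentiableAt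
  have h (w : E) : fderiv ℝ (fun y => fderiv ℝ f y w) z = (fderiv ℝ (fderiv ℝ f) z).flip w := by
    have := (hd.hasFDerivAt.clm_apply (hasFDerivAt_const w z)).fderiv
    rw [this]; ext; simp
  have hs : IsSymmSndFDerivAt ℝ f z := hf.contDiffAt.isSymmSndFDerivAt_of_omega
  rw [h, h]
  simpa using hs v u

namespace LowDimTori

variable {N m : ℕ} {a : (Fin N → ℝ) → (Fin N → ℝ)} {U : Set (Fin N → ℝ)}

theorem analyticAt_apply {z : Fin N → ℝ} (ha : AnalyticAt ℝ a z) (r : Fin N) :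
    AnalyticAt ℝ (fun y => a y r) z :=
  analyticAt_pi_iff.1 ha r

theorem analyticAt_sympMatrix {z : Fin N → ℝ} (ha : AnalyticAt ℝ a z) (r s : Fin N) :
    AnalyticAt ℝ (fun y => sympMatrix a y r s) z := by
  simp only [sympMatrix, Matrix.sub_apply, Matrix.transpose_apply, jacobian, Matrix.of_apply]
  exact ((analyticAt_apply ha s).fderiv_apply_const _).sub
    ((analyticAt_apply ha r).fderiv_apply_const _)

theorem sympMatrix_transpose (a : (Fin N → ℝ) → (Fin N → ℝ)) (z : Fin N → ℝ) :
    (sympMatrix a z).transpose = -sympMatrix a z := by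
  simp [sympMatrix, Matrix.transpose_sub]

/-- The derivative of the matrix-valued map `Ω` at `z` in the direction `v`. -/
noncomputable def sympDeriv (a : (Fin N → ℝ) → (Fin N → ℝ)) (z v : Fin N → ℝ) :
    Matrix (Fin N) (Fin N) ℝ :=
  Matrix.of fun r s => fderiv ℝ (fun y => sympMatrix a y r s) z v

theorem fderiv_apply_eq_sum (f : (Fin N → ℝ) → ℝ) (z v : Fin N → ℝ) :
    fderiv ℝ f z v = ∑ t, v t * fderiv ℝ f z (Pi.single t 1) := by
  conv_lhs => rw [pi_eq_sum_univ' v]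
  rw [map_sum]
  refine Finset.sum_congr rfl fun t _ => ?_
  rw [map_smul, smul_eq_mul]

/-- The 2-form `Ω` is closed. -/
theorem sympMatrix_closed {z : Fin N → ℝ} (ha : AnalyticAt ℝ a z) (r s t : Fin N) :
    fderiv ℝ (fun y => sympMatrix a y r s) z (Pi.single t 1)
      + fderiv ℝ (fun y => sympMatrix a y s t) z (Pi.single r 1)
      + fderiv ℝ (fun y => sympMatrix a y t r) z (Pi.single s 1) = 0 := by
  have hd (i j : Fin N) : DifferentiableAt ℝ
      (fun y => fderiv ℝ (fun x => a x i) y (Pi.single j 1)) z :=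
    ((analyticAt_apply ha i).fderiv_apply_const _).differentiableAt
  have h (i j k : Fin N) : fderiv ℝ (fun y => sympMatrix a y i j) z (Pi.single k 1)
      = fderiv ℝ (fun y => fderiv ℝ (fun x => a x j) y (Pi.single i 1)) z (Pi.single k 1)
        - fderiv ℝ (fun y => fderiv ℝ (fun x => a x i) y (Pi.single j 1)) z (Pi.single k 1) := by
    simp only [sympMatrix, Matrix.sub_apply, Matrix.transpose_apply, jacobian, Matrix.of_apply]
    rw [fderiv_fun_sub (hd _ _) (hd _ _)]; rfl
  rw [h, h, h, (analyticAt_apply ha s).fderiv_fderiv_comm (Pi.single r 1) (Pi.single t 1),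
    (analyticAt_apply ha t).fderiv_fderiv_comm (Pi.single r 1) (Pi.single s 1),
    (analyticAt_apply ha r).fderiv_fderiv_comm (Pi.single s 1) (Pi.single t 1)]
  ring

theorem analyticAt_hamField_prod {F : Type*} [NormedAddCommGroup F] [NormedSpace ℝ F]
    {h : F → (Fin N → ℝ) → ℝ} {p : (Fin N → ℝ) × F} (ha : AnalyticAt ℝ a p.1)
    (hdet : (sympMatrix a p.1).det ≠ 0)
    (hh : AnalyticAt ℝ (fun q : (Fin N → ℝ) × F => h q.2 q.1) p) (r : Fin N) :
    AnalyticAt ℝ (fun q : (Fin N → ℝ) × F => hamField a (h q.2) q.1 r) p := by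
  simp only [hamField, Matrix.mulVec, dotProduct, grad]
  refine Finset.analyticAt_fun_sum _ fun s _ => ?_
  refine AnalyticAt.mul ?_ (hh.fderiv_fst_apply (Pi.single s 1))
  exact (AnalyticAt.matrix_inv (analyticAt_sympMatrix ha) hdet r s).comp_of_eq
    (analyticAt_fst (p := p)) rfl

theorem analyticAt_jacobian_hamField_prod {F : Type*} [NormedAddCommGroup F] [NormedSpace ℝ F]
    {h : F → (Fin N → ℝ) → ℝ} {p : (Fin N → ℝ) × F} (ha : AnalyticAt ℝ a p.1)
    (hdet : (sympMatrix a p.1).det ≠ 0)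
    (hh : AnalyticAt ℝ (fun q : (Fin N → ℝ) × F => h q.2 q.1) p) (r s : Fin N) :
    AnalyticAt ℝ (fun q : (Fin N → ℝ) × F => jacobian (hamField a (h q.2)) q.1 r s) p :=
  (analyticAt_hamField_prod ha hdet hh r).fderiv_fst_apply (Pi.single s 1)

theorem analyticAt_hamField {h : (Fin N → ℝ) → ℝ} {z : Fin N → ℝ} (ha : AnalyticAt ℝ a z)
    (hdet : (sympMatrix a z).det ≠ 0) (hh : AnalyticAt ℝ h z) (r : Fin N) :
    AnalyticAt ℝ (fun y => hamField a h y r) z := by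
  simp only [hamField, Matrix.mulVec, dotProduct, grad]
  exact Finset.analyticAt_fun_sum _ fun s _ =>
    (AnalyticAt.matrix_inv (analyticAt_sympMatrix ha) hdet r s).mul (hh.fderiv_apply_const _)

/-- The Hamiltonian field is locally Hamiltonian: `L_{X_h} Ω = 0`, in matrix form. -/
theorem lieDerivative_sympMatrix {h : (Fin N → ℝ) → ℝ} {z : Fin N → ℝ} (ha : AnalyticAt ℝ a z)
    (hdet : (sympMatrix a z).det ≠ 0) (hh : AnalyticAt ℝ h z) :
    (jacobian (hamField a h) z).transpose * sympMatrix a z + sympDeriv a z (hamField a h z)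
      + sympMatrix a z * jacobian (hamField a h) z = 0 := by
  have hΩX : ∀ᶠ y in nhds z, ∀ r, ∑ t, sympMatrix a y r t * hamField a h y t
      = fderiv ℝ h y (Pi.single r 1) := by
    have hne := (AnalyticAt.matrix_det (analyticAt_sympMatrix ha)).continuousAt.eventually_ne hdet
    filter_upwards [hne] with y hy r
    have : (sympMatrix a y).mulVec (hamField a h y) = grad h y := by
      rw [hamField, Matrix.mulVec_mulVec, Matrix.mul_nonsing_inv _ (isUnit_iff_ne_zero.2 hy),
        Matrix.one_mulVec]
    exact congrFun this r
  have hdΩ (r s : Fin N) := (analyticAt_sympMatrix ha r s).differentiableAt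
  have hdX (r : Fin N) := (analyticAt_hamField ha hdet hh r).differentiableAt
  -- differentiating `Ω X = ∇h` in the direction `e_s`
  have key (r s : Fin N) :
      ∑ t, (sympMatrix a z r t * jacobian (hamField a h) z t s
        + hamField a h z t * fderiv ℝ (fun y => sympMatrix a y r t) z (Pi.single s 1))
      = fderiv ℝ (fun y => fderiv ℝ h y (Pi.single r 1)) z (Pi.single s 1) := by
    have e : (fun y => ∑ t, sympMatrix a y r t * hamField a h y t) =ᶠ[nhds z]
        fun y => fderiv ℝ h y (Pi.single r 1) := hΩX.mono fun y hy => hy r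
    rw [← e.fderiv_eq, fderiv_fun_sum fun t _ => (hdΩ r t).fun_mul (hdX t),
      sum_apply]
    refine Finset.sum_congr rfl fun t _ => ?_
    rw [fderiv_fun_mul (hdΩ r t) (hdX t)]
    simp [jacobian]
  ext r s
  have k1 := key r s
  have k2 := key s r
  rw [hh.fderiv_fderiv_comm (Pi.single s 1) (Pi.single r 1), ← k1] at k2
  simp only [Matrix.add_apply, Matrix.mul_apply, Matrix.transpose_apply, Matrix.zero_apply,
    sympDeriv, Matrix.of_apply]
  rw [fderiv_apply_eq_sum, ← Finset.sum_add_distrib, ← Finset.sum_add_distrib]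
  rw [← sub_eq_zero, ← Finset.sum_sub_distrib] at k2
  rw [← neg_eq_zero, ← Finset.sum_neg_distrib, ← k2]
  refine Finset.sum_congr rfl fun t _ => ?_
  have c := sympMatrix_closed ha r s t
  have anti (i j : Fin N) (y : Fin N → ℝ) : sympMatrix a y i j = -sympMatrix a y j i := by
    have := congrFun (congrFun (sympMatrix_transpose a y) j) i
    simpa using this
  have e1 : fderiv ℝ (fun y => sympMatrix a y t r) z (Pi.single s 1)
      = -fderiv ℝ (fun y => sympMatrix a y r t) z (Pi.single s 1) := by
    simp_rw [anti t r]; rw [fderiv_fun_neg]; rfl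
  rw [anti s t z]
  linear_combination (-hamField a h z t) * c + hamField a h z t * e1

end LowDimTori

/-! ### Cauchy estimates on the strip -/

namespace LowDimTori

variable {d : ℕ} {ι κ : Type*} [Fintype κ]

theorem ofReal_mem_strip {δ : ℝ} (hδ : 0 < δ) (θ : Fin d → ℝ) :
    (fun l => (θ l : ℂ)) ∈ strip d δ := fun j => by simpa using hδ

theorem enorm_le_stripNorm {δ : ℝ} (hδ : 0 < δ) (f : (Fin d → ℝ) → Matrix ι κ ℝ)
    (θ : Fin d → ℝ) (i : ι) (j : κ) : ‖f θ i j‖ₑ ≤ stripNorm δ f := by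
  refine le_iInf fun F => le_iInf fun hF => ?_
  have h1 : ‖f θ i j‖ₑ = ‖F (fun l => (θ l : ℂ)) i j‖ₑ := by
    rw [hF.2 θ i j, ← ofReal_norm, ← ofReal_norm, Complex.norm_real]
  rw [h1]
  refine le_trans (Finset.single_le_sum (f := fun j => ‖F (fun l => (θ l : ℂ)) i j‖ₑ)
    (fun _ _ => zero_le) (Finset.mem_univ j)) ?_
  exact le_iSup₂_of_le (fun l => (θ l : ℂ)) (ofReal_mem_strip hδ θ)
    (le_iSup (fun i => ∑ j, ‖F (fun l => (θ l : ℂ)) i j‖ₑ) i)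

theorem abs_le_of_stripNorm_le {δ : ℝ} (hδ : 0 < δ) {f : (Fin d → ℝ) → Matrix ι κ ℝ} {R : ℝ≥0}
    (hf : stripNorm δ f ≤ R) (θ : Fin d → ℝ) (i : ι) (j : κ) : |f θ i j| ≤ R := by
  have := (enorm_le_stripNorm hδ f θ i j).trans hf
  rw [← Real.norm_eq_abs, ← coe_nnnorm]
  exact_mod_cast this

theorem exists_stripExtension_le {ρ : ℝ} {f : (Fin d → ℝ) → Matrix ι κ ℝ} {R : ℝ≥0}
    (hf : stripNorm ρ f ≤ R) :
    ∃ F, IsStripExtension ρ f F ∧ ∀ z ∈ strip d ρ, ∀ i j, ‖F z i j‖ ≤ R + 1 := by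
  have hlt : stripNorm ρ f < ((R + 1 : ℝ≥0) : ℝ≥0∞) :=
    lt_of_le_of_lt hf (by exact_mod_cast lt_add_one R)
  obtain ⟨F, hF⟩ := iInf_lt_iff.1 hlt
  obtain ⟨hext, hb⟩ := iInf_lt_iff.1 hF
  refine ⟨F, hext, fun z hz i j => ?_⟩
  have h : ‖F z i j‖ₑ ≤ ((R + 1 : ℝ≥0) : ℝ≥0∞) := by
    refine le_trans ?_ hb.le
    refine le_trans (Finset.single_le_sum (f := fun j => ‖F z i j‖ₑ)
      (fun _ _ => zero_le) (Finset.mem_univ j)) ?_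
    exact le_iSup₂_of_le z hz (le_iSup (fun i => ∑ j, ‖F z i j‖ₑ) i)
  have h' : ‖F z i j‖₊ ≤ R + 1 := by exact_mod_cast h
  exact_mod_cast h'

theorem isOpen_strip (d : ℕ) (ρ : ℝ) : IsOpen (strip d ρ) := by
  have : strip d ρ = ⋂ j, {z | |(z j).im| < ρ} := by ext; simp [strip]
  rw [this]
  exact isOpen_iInter_of_finite fun j => isOpen_lt (by fun_prop) continuous_const

theorem differentiable_of_stripNorm_le {ρ : ℝ} (hρ : 0 < ρ) {f : (Fin d → ℝ) → Matrix ι κ ℝ}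
    {R : ℝ≥0} (hf : stripNorm ρ f ≤ R) (i : ι) (j : κ) : Differentiable ℝ (fun θ => f θ i j) := by
  obtain ⟨F, hF, -⟩ := exists_stripExtension_le hf
  intro θ
  have h1 : DifferentiableAt ℂ (fun z => F z i j) (fun l => (θ l : ℂ)) :=
    (hF.1 i j).differentiableAt ((isOpen_strip d ρ).mem_nhds (ofReal_mem_strip hρ θ))
  have h2 : DifferentiableAt ℝ (fun η : Fin d → ℝ => fun l => (η l : ℂ)) θ :=
    differentiableAt_pi.2 fun l =>
      (Complex.ofRealCLM.differentiableAt).comp θ (differentiableAt_apply l θ)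
  have h3 := Complex.reCLM.differentiableAt.comp θ ((h1.restrictScalars ℝ).comp θ h2)
  have e : (fun θ => f θ i j) = Complex.reCLM ∘ (fun z => F z i j) ∘
      fun η : Fin d → ℝ => fun l => (η l : ℂ) := by
    funext η; simp [hF.2 η i j]
  rw [e]; exact h3

/-- A map with norm at most `R` on the strip of width `ρ` is Lipschitz on `𝕋ᵈ`, with a constant
that depends only on `R` and `ρ`. This is the Schwarz lemma on complex lines. -/
theorem lipschitz_of_stripNorm_le {ρ : ℝ} (hρ : 0 < ρ) {f : (Fin d → ℝ) → Matrix ι κ ℝ}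
    {R : ℝ≥0} (hf : stripNorm ρ f ≤ R) (i : ι) (j : κ) (θ θ' : Fin d → ℝ) :
    |f θ' i j - f θ i j| ≤ 2 * (R + 1) / ρ * ‖θ' - θ‖ := by
  obtain ⟨F, hF, hb⟩ := exists_stripExtension_le hf
  set v := θ' - θ with hv
  have hR : (0 : ℝ) ≤ R := R.2
  have hreal (η : Fin d → ℝ) : |f η i j| ≤ R + 1 := by
    have := hb _ (ofReal_mem_strip hρ η) i j
    rwa [hF.2 η i j, Complex.norm_real, Real.norm_eq_abs] at this
  rcases lt_or_ge ‖v‖ ρ with hlt | hge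
  · rcases eq_or_ne v 0 with h0 | h0
    · have : θ' = θ := sub_eq_zero.1 (hv ▸ h0)
      simp [this, h0]
    have hvp : 0 < ‖v‖ := norm_pos_iff.2 h0
    -- the restriction of `F` to the complex line through `θ` and `θ'`, on a disc of radius `> 1`
    let g : ℂ → ℂ := fun z => F (fun l => (θ l : ℂ) + z * (v l : ℂ)) i j
    have hmem : ∀ z ∈ Metric.ball (0 : ℂ) (ρ / ‖v‖),
        (fun l => (θ l : ℂ) + z * (v l : ℂ)) ∈ strip d ρ := by
      intro z hz l
      rw [mem_ball_zero_iff, lt_div_iff₀ hvp] at hz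
      have : ((θ l : ℂ) + z * (v l : ℂ)).im = z.im * v l := by simp
      simp only [this, abs_mul]
      refine lt_of_le_of_lt ?_ hz
      exact mul_le_mul (Complex.abs_im_le_norm z) (norm_le_pi_norm v l) (abs_nonneg _)
        (norm_nonneg _)
    have hd : DifferentiableOn ℂ g (Metric.ball 0 (ρ / ‖v‖)) := by
      have : DifferentiableOn ℂ (fun z : ℂ => fun l => (θ l : ℂ) + z * (v l : ℂ))
          (Metric.ball 0 (ρ / ‖v‖)) :=
        differentiableOn_pi.2 fun l => by fun_prop
      exact (hF.1 i j).comp this hmem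
    have h0mem : (0 : ℂ) ∈ Metric.ball (0 : ℂ) (ρ / ‖v‖) :=
      Metric.mem_ball_self (div_pos hρ hvp)
    have hmaps : Set.MapsTo g (Metric.ball 0 (ρ / ‖v‖))
        (Metric.closedBall (g 0) (2 * (R + 1))) := by
      intro z hz
      rw [mem_closedBall_iff_norm]
      refine (norm_sub_le _ _).trans ?_
      have h1 := hb _ (hmem z hz) i j
      have h2 := hb _ (hmem 0 h0mem) i j
      calc ‖g z‖ + ‖g 0‖ ≤ (R + 1) + (R + 1) := add_le_add h1 h2
        _ = 2 * (R + 1) := by ring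
    have h1mem : (1 : ℂ) ∈ Metric.ball (0 : ℂ) (ρ / ‖v‖) := by
      rw [mem_ball_zero_iff, norm_one, lt_div_iff₀ hvp]; linarith
    have := Complex.dist_le_div_mul_dist_of_mapsTo_ball hd hmaps h1mem
    have e0 : g 0 = (f θ i j : ℂ) := by
      simp only [g, zero_mul, add_zero]; exact hF.2 θ i j
    have e1 : g 1 = (f θ' i j : ℂ) := by
      rw [← hF.2 θ' i j]
      simp only [g, hv, one_mul, Pi.sub_apply, Complex.ofReal_sub, add_sub_cancel]
    rw [e0, e1, dist_eq_norm, ← Complex.ofReal_sub, Complex.norm_real, Real.norm_eq_abs] at this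
    simp only [dist_zero_right, norm_one, mul_one] at this
    convert this using 1
    field_simp
  · have h1 : |f θ' i j - f θ i j| ≤ 2 * (R + 1) := by
      refine (abs_sub _ _).trans ?_
      linarith [hreal θ, hreal θ']
    refine h1.trans ?_
    rw [div_mul_eq_mul_div, le_div_iff₀ hρ]
    gcongr

end LowDimTori

/-! ### Fourier coefficients and compactness on the torus -/

namespace LowDimTori

open MeasureTheory UnitAddTorus Filter Topology BoundedContinuousFunction

variable {d : ℕ}

/-- The covering map `ℝᵈ → (ℝ/ℤ)ᵈ` with kernel `(2πℤ)ᵈ`. -/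
noncomputable def torusMap (θ : Fin d → ℝ) : UnitAddTorus (Fin d) :=
  fun i => ((θ i / (2 * Real.pi) : ℝ) : UnitAddCircle)

theorem torusMap_add (θ η : Fin d → ℝ) : torusMap (θ + η) = torusMap θ + torusMap η := by
  funext i; simp [torusMap, add_div]

theorem isOpenQuotientMap_torusMap : IsOpenQuotientMap (torusMap (d := d)) := by
  have h : IsOpenQuotientMap (fun x : ℝ => ((x / (2 * Real.pi) : ℝ) : UnitAddCircle)) := by
    have h1 : IsOpenQuotientMap (fun x : ℝ => x / (2 * Real.pi)) :=
      by
      simp only [div_eq_mul_inv]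
      exact (Homeomorph.mulRight₀ (2 * Real.pi)⁻¹
        (inv_ne_zero Real.two_pi_pos.ne')).isOpenQuotientMap
    have h2 : IsOpenQuotientMap (fun x : ℝ => (x : UnitAddCircle)) :=
      QuotientAddGroup.isOpenQuotientMap_mk
    exact h2.comp h1
  exact IsOpenQuotientMap.piMap fun _ => h

theorem exists_of_torusMap_eq {θ θ' : Fin d → ℝ} (h : torusMap θ = torusMap θ') :
    ∃ k : Fin d → ℤ, θ' = fun j => θ j + 2 * Real.pi * (k j : ℝ) := by
  have h1 (j : Fin d) : ∃ k : ℤ, θ' j = θ j + 2 * Real.pi * (k : ℝ) := by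
    have := congrFun h j
    simp only [torusMap] at this
    rw [← sub_eq_zero, ← AddCircle.coe_sub, AddCircle.coe_eq_zero_iff] at this
    obtain ⟨k, hk⟩ := this
    refine ⟨-k, ?_⟩
    have hp := Real.two_pi_pos.ne'
    rw [zsmul_eq_mul, mul_one, ← sub_div, eq_div_iff hp] at hk
    push_cast
    linarith
  choose k hk using h1
  exact ⟨k, funext hk⟩

/-- A continuous periodic function on `ℝᵈ` is a continuous function on the torus. -/
theorem TorusPeriodic.exists_lift {E : Type*} [TopologicalSpace E] {f : (Fin d → ℝ) → E}
    (hf : TorusPeriodic f) (hc : Continuous f) :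
    ∃ g : C(UnitAddTorus (Fin d), E), ∀ θ, g (torusMap θ) = f θ := by
  have hq : IsQuotientMap (⟨torusMap, isOpenQuotientMap_torusMap.continuous⟩ :
      C(Fin d → ℝ, UnitAddTorus (Fin d))) := isOpenQuotientMap_torusMap.isQuotientMap
  have hfac : Function.FactorsThrough (⟨f, hc⟩ : C(Fin d → ℝ, E))
      (⟨torusMap, isOpenQuotientMap_torusMap.continuous⟩ :
        C(Fin d → ℝ, UnitAddTorus (Fin d))) := by
    intro θ θ' h
    obtain ⟨k, rfl⟩ := exists_of_torusMap_eq h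
    exact (hf θ k).symm
  exact ⟨hq.lift ⟨f, hc⟩ hfac,
    fun θ => congrFun (congrArg DFunLike.coe (hq.lift_comp ⟨f, hc⟩ hfac)) θ⟩

theorem mFourier_torusMap (k : Fin d → ℤ) (θ : Fin d → ℝ) :
    mFourier k (torusMap θ) = Complex.exp (Complex.I * ((∑ l, (k l : ℝ) * θ l : ℝ) : ℂ)) := by
  simp only [mFourier, torusMap, ContinuousMap.coe_mk, fourier_coe_apply]
  rw [← Complex.exp_sum]
  congr 1
  push_cast
  rw [Finset.mul_sum]
  refine Finset.sum_congr rfl fun l _ => ?_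
  have : (Real.pi : ℂ) ≠ 0 := by exact_mod_cast Real.pi_ne_zero
  field_simp

/-- The normalised Haar measure of the torus `(ℝ/ℤ)ᵈ`. -/
noncomputable def torusMeasure (d : ℕ) : Measure (UnitAddTorus (Fin d)) :=
  Measure.pi fun _ => AddCircle.haarAddCircle

instance : IsProbabilityMeasure (torusMeasure d) :=
  inferInstanceAs (IsProbabilityMeasure (Measure.pi fun _ => AddCircle.haarAddCircle))

instance : (torusMeasure d).IsAddHaarMeasure :=
  inferInstanceAs ((Measure.pi fun _ : Fin d =>
    (AddCircle.haarAddCircle : Measure UnitAddCircle)).IsAddHaarMeasure)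

/-- The Fourier coefficient of index `k` of a function on the torus. -/
noncomputable def torusCoeff (g : UnitAddTorus (Fin d) → ℂ) (k : Fin d → ℤ) : ℂ :=
  ∫ x, mFourier (-k) x * g x ∂(torusMeasure d)

theorem eq_zero_of_torusCoeff_eq_zero (g : C(UnitAddTorus (Fin d), ℂ))
    (h : ∀ k, torusCoeff g k = 0) (x : UnitAddTorus (Fin d)) : g x = 0 := by
  have h0 : mFourierCoeff g = 0 := funext fun k => h k
  have hs : Summable (mFourierCoeff g) := by rw [h0]; exact summable_zero
  have := hasSum_mFourier_series_apply_of_summable hs x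
  rw [h0] at this
  simpa using this.unique (by simp)

theorem integrable_torus (g : C(UnitAddTorus (Fin d), ℂ)) : Integrable g (torusMeasure d) :=
  g.continuous.integrable_of_hasCompactSupport (HasCompactSupport.of_compactSpace _)

theorem norm_integral_torus_le {g : UnitAddTorus (Fin d) → ℂ} {C : ℝ} (h : ∀ x, ‖g x‖ ≤ C) :
    ‖∫ x, g x ∂(torusMeasure d)‖ ≤ C := by
  simpa using norm_integral_le_of_norm_le_const (μ := torusMeasure d) (Eventually.of_forall h)

theorem norm_mFourier_apply (k : Fin d → ℤ) (x : UnitAddTorus (Fin d)) : ‖mFourier k x‖ = 1 := by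
  obtain ⟨θ, rfl⟩ := isOpenQuotientMap_torusMap.surjective x
  rw [mFourier_torusMap, mul_comm, Complex.norm_exp_ofReal_mul_I]

theorem torusCoeff_translate (g : UnitAddTorus (Fin d) → ℂ) (k : Fin d → ℤ) (θ : Fin d → ℝ) :
    torusCoeff (fun x => g (x + torusMap θ)) k = mFourier k (torusMap θ) * torusCoeff g k := by
  unfold torusCoeff
  have h (x : UnitAddTorus (Fin d)) : mFourier (-k) x * g (x + torusMap θ)
      = (fun y => mFourier k (torusMap θ) * (mFourier (-k) y * g y)) (x + torusMap θ) := by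
    obtain ⟨η, rfl⟩ := isOpenQuotientMap_torusMap.surjective x
    simp only
    rw [← torusMap_add, mFourier_torusMap, mFourier_torusMap, mFourier_torusMap, ← mul_assoc,
      ← Complex.exp_add]
    congr 2
    simp only [Pi.neg_apply, Pi.add_apply, Int.cast_neg, neg_mul, mul_add, Finset.sum_neg_distrib,
      Finset.sum_add_distrib, Complex.ofReal_add, Complex.ofReal_neg]
    ring
  rw [integral_congr_ae (Eventually.of_forall h), integral_add_right_eq_self
    (μ := torusMeasure d) (fun y => mFourier k (torusMap θ) * (mFourier (-k) y * g y)) (torusMap θ),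
    integral_const_mul]

/-- If `∂_ω g + μ g` is bounded by `ε`, then `(i k·ω + μ) ĝ(k)` is bounded by `ε`. The proof
integrates the equation along the flow over a time `T → 0⁺`, so that no regularity of `∂_ω g` is
needed. -/
theorem norm_mul_torusCoeff_le (g : C(UnitAddTorus (Fin d), ℂ)) (ω : Fin d → ℝ) (μ : ℂ) {ε : ℝ}
    (hg : ∀ θ, ∃ g' : ℂ, HasDerivAt (fun t : ℝ => g (torusMap (θ + t • ω))) g' 0 ∧
      ‖g' + μ * g (torusMap θ)‖ ≤ ε) (k : Fin d → ℤ) :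
    ‖Complex.I * ((∑ l, (k l : ℝ) * ω l : ℝ) : ℂ) + μ‖ * ‖torusCoeff g k‖ ≤ ε := by
  set ν : ℂ := Complex.I * ((∑ l, (k l : ℝ) * ω l : ℝ) : ℂ) with hν
  have hε : 0 ≤ ε := by
    obtain ⟨g', -, h⟩ := hg 0
    exact (norm_nonneg _).trans h
  -- the derivative of `g e^{μt}` along the flow is `(∂_ω g + μ g) e^{μt}`
  have duhamel (θ : Fin d → ℝ) {T : ℝ} (hT : 0 < T) :
      ‖g (torusMap (θ + T • ω)) * Complex.exp (μ * T) - g (torusMap θ)‖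
        ≤ Real.exp (‖μ‖ * T) * ε * T := by
    have hder (t : ℝ) : ∃ e : ℂ, HasDerivAt
        (fun t : ℝ => g (torusMap (θ + t • ω)) * Complex.exp (μ * t)) (e * Complex.exp (μ * t)) t
          ∧ ‖e‖ ≤ ε := by
      obtain ⟨g', h1, h2⟩ := hg (θ + t • ω)
      refine ⟨g' + μ * g (torusMap (θ + t • ω)), ?_, h2⟩
      have h3 : HasDerivAt (fun s : ℝ => g (torusMap (θ + s • ω))) g' t := by
        have h4 := HasDerivAt.comp_sub_const (f := fun t' : ℝ => g (torusMap (θ + t • ω + t' • ω)))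
          (f' := g') t t (by simpa using h1)
        refine h4.congr_of_eventuallyEq (Eventually.of_forall fun s => ?_)
        simp only
        congr 2
        rw [sub_smul]; abel
      have h5 : HasDerivAt (fun s : ℝ => Complex.exp (μ * s)) (Complex.exp (μ * t) * μ) t := by
        have : HasDerivAt (fun s : ℝ => μ * (s : ℂ)) μ t := by
          simpa using (Complex.ofRealCLM.hasDerivAt (x := t)).const_mul μ
        exact this.cexp
      convert! h3.mul h5 using 1
      ring
    choose e he1 he2 using hder
    have := norm_image_sub_le_of_norm_deriv_le_segment' (a := 0) (b := T)
      (C := Real.exp (‖μ‖ * T) * ε)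
      (fun t _ => (he1 t).hasDerivWithinAt) (fun t ht => by
        rw [norm_mul, mul_comm]
        refine mul_le_mul ?_ (he2 t) (norm_nonneg _) (Real.exp_pos _).le
        rw [Complex.norm_exp]
        refine Real.exp_le_exp.2 ((Complex.re_le_norm _).trans ?_)
        rw [norm_mul, Complex.norm_real, Real.norm_of_nonneg ht.1]
        exact mul_le_mul_of_nonneg_left ht.2.le (norm_nonneg _)) T (Set.right_mem_Icc.2 hT.le)
    simpa using this
  -- translation by `T ω` multiplies the Fourier coefficient by `exp (i k·ω T)`
  have step {T : ℝ} (hT : 0 < T) :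
      ‖T⁻¹ • (Complex.exp ((ν + μ) * T) - 1)‖ * ‖torusCoeff g k‖ ≤ Real.exp (‖μ‖ * T) * ε := by
    have e1 : (Complex.exp ((ν + μ) * T) - 1) * torusCoeff g k
        = ∫ x, mFourier (-k) x * (g (x + torusMap (T • ω)) * Complex.exp (μ * T) - g x)
            ∂(torusMeasure d) := by
      have t1 := torusCoeff_translate g k (T • ω)
      have i1 : Integrable (fun x => mFourier (-k) x * g (x + torusMap (T • ω)))
          (torusMeasure d) :=
        integrable_torus ⟨fun x => mFourier (-k) x * g (x + torusMap (T • ω)), by fun_prop⟩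
      have i2 : Integrable (fun x => mFourier (-k) x * g x) (torusMeasure d) :=
        integrable_torus (mFourier (-k) * g)
      have : ∀ x, mFourier (-k) x * (g (x + torusMap (T • ω)) * Complex.exp (μ * T) - g x)
          = Complex.exp (μ * T) * (mFourier (-k) x * g (x + torusMap (T • ω)))
            - mFourier (-k) x * g x := fun x => by ring
      simp_rw [this]
      rw [integral_sub (i1.const_mul _) i2, integral_const_mul]
      change _ = Complex.exp (μ * T) * torusCoeff (fun x => g (x + torusMap (T • ω))) k
        - torusCoeff g k
      rw [t1, mFourier_torusMap]
      have e2 : Complex.I * ((∑ l, (k l : ℝ) * (T • ω) l : ℝ) : ℂ) = ν * T := by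
        rw [hν, mul_assoc, ← Complex.ofReal_mul, Finset.sum_mul]
        congr 2
        refine Finset.sum_congr rfl fun l _ => ?_
        simp only [Pi.smul_apply, smul_eq_mul]; ring
      rw [e2, add_mul, Complex.exp_add]; ring
    have e3 : ‖(Complex.exp ((ν + μ) * T) - 1) * torusCoeff g k‖
        ≤ Real.exp (‖μ‖ * T) * ε * T := by
      rw [e1]
      refine norm_integral_torus_le fun x => ?_
      obtain ⟨θ, rfl⟩ := isOpenQuotientMap_torusMap.surjective x
      rw [norm_mul, norm_mFourier_apply, one_mul, ← torusMap_add]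
      exact duhamel θ hT
    rw [norm_smul, mul_assoc, ← norm_mul, norm_inv, Real.norm_of_nonneg hT.le,
      inv_mul_le_iff₀ hT]
    linarith
  have hlim1 : Tendsto (fun T : ℝ => ‖T⁻¹ • (Complex.exp ((ν + μ) * T) - 1)‖ * ‖torusCoeff g k‖)
      (𝓝[>] 0) (𝓝 (‖ν + μ‖ * ‖torusCoeff g k‖)) := by
    have : HasDerivAt (fun s : ℝ => Complex.exp ((ν + μ) * s)) (ν + μ) 0 := by
      have h : HasDerivAt (fun s : ℝ => (ν + μ) * (s : ℂ)) (ν + μ) 0 := by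
        simpa using (Complex.ofRealCLM.hasDerivAt (x := 0)).const_mul (ν + μ)
      simpa using h.cexp
    have h2 := (hasDerivAt_iff_tendsto_slope_zero.1 this).mono_left (nhdsGT_le_nhdsNE 0)
    simp only [zero_add, Complex.ofReal_zero, mul_zero, Complex.exp_zero] at h2
    exact h2.norm.mul_const _
  have hlim2 : Tendsto (fun T : ℝ => Real.exp (‖μ‖ * T) * ε) (𝓝[>] 0) (𝓝 ε) := by
    have : Continuous (fun T : ℝ => Real.exp (‖μ‖ * T) * ε) := by fun_prop
    have h := (this.tendsto 0).mono_left (nhdsWithin_le_nhds (s := Set.Ioi 0))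
    simpa using h
  exact le_of_tendsto_of_tendsto hlim1 hlim2
    (eventually_nhdsWithin_of_forall fun T hT => step hT)

/-- If at each point of a compact set some member of a family of continuous functions is positive,
then at each point some member exceeds a uniform positive constant. -/
theorem _root_.IsCompact.exists_forall_exists_lt {X I : Type*} [TopologicalSpace X] {s : Set X}
    (hs : IsCompact s) {φ : I → X → ℝ} (hφ : ∀ i, Continuous (φ i))
    (hpos : ∀ x ∈ s, ∃ i, 0 < φ i x) : ∃ κ > 0, ∀ x ∈ s, ∃ i, κ < φ i x := by
  let V : ℕ → Set X := fun q => ⋃ i, {x | 1 / ((q : ℝ) + 1) < φ i x}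
  have hV : ∀ q, IsOpen (V q) := fun q =>
    isOpen_iUnion fun i => isOpen_lt continuous_const (hφ i)
  have hmono : Monotone V := by
    intro p q hpq x hx
    obtain ⟨i, hi⟩ := Set.mem_iUnion.1 hx
    have hq : 1 / ((q : ℝ) + 1) < φ i x := (Nat.one_div_le_one_div hpq).trans_lt hi
    exact Set.mem_iUnion.2 ⟨i, hq⟩
  have hcov : s ⊆ ⋃ q, V q := by
    intro x hx
    obtain ⟨i, hi⟩ := hpos x hx
    obtain ⟨q, hq⟩ := exists_nat_one_div_lt hi
    exact Set.mem_iUnion.2 ⟨q, Set.mem_iUnion.2 ⟨i, hq⟩⟩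
  obtain ⟨q, hq⟩ := hs.elim_directed_cover V hV hcov hmono.directed_le
  exact ⟨1 / ((q : ℝ) + 1), Nat.one_div_pos_of_nat, fun x hx => Set.mem_iUnion.1 (hq hx)⟩

theorem continuous_torusCoeff_entry {ι : Type*} [Fintype ι] (a b : ι) (k : Fin d → ℤ) :
    Continuous fun f : UnitAddTorus (Fin d) →ᵇ (ι → ι → ℂ) =>
      torusCoeff (fun x => f x a b) k := by
  refine (LipschitzWith.of_dist_le_mul (K := 1) fun f g => ?_).continuous
  have hi (f : UnitAddTorus (Fin d) →ᵇ (ι → ι → ℂ)) :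
      Integrable (fun x => mFourier (-k) x * f x a b) (torusMeasure d) :=
    integrable_torus ⟨fun x => mFourier (-k) x * f x a b, by fun_prop⟩
  rw [dist_eq_norm, torusCoeff, torusCoeff, ← integral_sub (hi f) (hi g), NNReal.coe_one, one_mul]
  refine norm_integral_torus_le fun x => ?_
  rw [← mul_sub, norm_mul, norm_mFourier_apply, one_mul, ← dist_eq_norm]
  exact ((dist_le_pi_dist _ _ b).trans (dist_le_pi_dist _ _ a)).trans (dist_coe_le_dist x)

/-- On a relatively compact family of matrix-valued functions with determinant bounded away from
zero, some weighted Fourier coefficient off the diagonal in row `a` is bounded away from zero: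
otherwise all of row `a` would vanish for some limit of the family. -/
theorem exists_lt_mul_torusCoeff {ι : Type*} [Fintype ι] [DecidableEq ι]
    {A : Set (UnitAddTorus (Fin d) →ᵇ (ι → ι → ℂ))} (hA : IsCompact (closure A)) {c : ℝ}
    (hc : 0 < c) (hdet : ∀ f ∈ A, ∀ x, c ≤ ‖(Matrix.of (f x)).det‖) (a : ι)
    (hdiag : ∀ f ∈ A, ∀ x, f x a a = 0) {w : (Fin d → ℤ) → ι → ℝ}
    (hw : ∀ k b, b ≠ a → 0 < w k b) :
    ∃ κ > 0, ∀ f ∈ A, ∃ k b, b ≠ a ∧ κ < w k b * ‖torusCoeff (fun x => f x a b) k‖ := by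
  have hcl : closure A ⊆ {f | ∀ x, c ≤ ‖(Matrix.of (f x)).det‖ ∧ f x a a = 0} := by
    refine closure_minimal (fun f hf x => ⟨hdet f hf x, hdiag f hf x⟩) ?_
    simp only [Set.ofPred_forall, Set.ofPred_and]
    refine isClosed_iInter fun x => IsClosed.inter ?_ ?_
    · refine isClosed_le continuous_const (Continuous.norm (Continuous.matrix_det ?_))
      exact continuous_eval_const x
    · refine isClosed_eq ?_ continuous_const
      have : Continuous fun f : UnitAddTorus (Fin d) →ᵇ (ι → ι → ℂ) => f x :=
        continuous_eval_const x
      fun_prop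
  obtain ⟨κ, hκ, h⟩ := hA.exists_forall_exists_lt
    (φ := fun (p : (Fin d → ℤ) × {b // b ≠ a}) f =>
      w p.1 p.2 * ‖torusCoeff (fun x => f x a p.2) p.1‖)
    (fun p => (continuous_torusCoeff_entry a p.2 p.1).norm.const_mul _) (by
      intro f hf
      by_contra! hneg
      have hrow (b : ι) (x : UnitAddTorus (Fin d)) : f x a b = 0 := by
        by_cases hb : b = a
        · subst hb; exact (hcl hf x).2
        · refine eq_zero_of_torusCoeff_eq_zero ⟨fun x => f x a b, by fun_prop⟩ (fun k => ?_) x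
          have h1 := hneg (k, ⟨b, hb⟩)
          have h2 := hw k b hb
          have h3 : ‖torusCoeff (fun x => f x a b) k‖ ≤ 0 := by
            by_contra! h4
            exact absurd (mul_pos h2 h4) (not_lt.2 h1)
          exact norm_le_zero_iff.1 h3
      have h0 := (hcl hf 0).1
      rw [Matrix.det_eq_zero_of_row_eq_zero (A := Matrix.of (f 0)) a fun b => hrow b 0,
        norm_zero] at h0
      linarith)
  refine ⟨κ, hκ, fun f hf => ?_⟩
  obtain ⟨⟨k, b, hb⟩, hlt⟩ := h f (subset_closure hf)
  exact ⟨k, b, hb, hlt⟩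

/-- Arzelà–Ascoli for the images, under a continuous map, of uniformly Lipschitz maps from the
torus to a compact set. -/
theorem isCompact_closure_lipschitz_comp {Y E : Type*} [PseudoMetricSpace Y] [MetricSpace E]
    {Z : Set Y} (hZ : IsCompact Z) {Φ : Y → E} (hΦ : ContinuousOn Φ Z) (L : ℝ) :
    IsCompact (closure {f : UnitAddTorus (Fin d) →ᵇ E | ∃ G : (Fin d → ℝ) → Y,
      (∀ θ, G θ ∈ Z) ∧ (∀ θ θ', dist (G θ) (G θ') ≤ L * dist θ θ') ∧
        ∀ θ, f (torusMap θ) = Φ (G θ)}) := by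
  refine arzela_ascoli (Φ '' Z) (hZ.image_of_continuousOn hΦ) _ ?_ ?_
  · rintro f x ⟨G, hG, -, hf⟩
    obtain ⟨θ, rfl⟩ := isOpenQuotientMap_torusMap.surjective x
    exact ⟨G θ, hG θ, (hf θ).symm⟩
  · intro x₀
    rw [Metric.equicontinuousAt_iff_right]
    intro ε hε
    obtain ⟨η, hη, hu⟩ := Metric.uniformContinuousOn_iff.1
      (hZ.uniformContinuousOn_of_continuous hΦ) ε hε
    obtain ⟨θ₀, rfl⟩ := isOpenQuotientMap_torusMap.surjective x₀
    have hL : Tendsto (fun θ : Fin d → ℝ => L * dist θ₀ θ) (𝓝 θ₀) (𝓝 0) := by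
      have : Continuous fun θ : Fin d → ℝ => L * dist θ₀ θ := by fun_prop
      simpa using this.tendsto θ₀
    have hev : ∀ᶠ θ in 𝓝 θ₀, L * dist θ₀ θ < η := hL.eventually_lt_const hη
    have hmap : map torusMap (𝓝 θ₀) = 𝓝 (torusMap θ₀) :=
      (isOpenQuotientMap_torusMap (d := d)).isOpenMap.map_nhds_eq
        isOpenQuotientMap_torusMap.continuous.continuousAt
    rw [← hmap, eventually_map]
    filter_upwards [hev] with θ hθ
    rintro ⟨f, G, hG, hLip, hf⟩
    simp only
    rw [hf, hf]
    exact hu _ (hG _) _ (hG _) ((hLip _ _).trans_lt hθ)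

end LowDimTori

/-! ### Derivatives and bounds of matrix products -/

namespace LowDimTori

theorem hasDerivAt_matrix_mul {R : Type*} [NormedRing R] [NormedAlgebra ℝ R]
    {ι κ σ : Type*} [Fintype κ] {A : ℝ → Matrix ι κ R} {B : ℝ → Matrix κ σ R}
    {A' : Matrix ι κ R} {B' : Matrix κ σ R} {t : ℝ}
    (hA : ∀ i j, HasDerivAt (fun s => A s i j) (A' i j) t)
    (hB : ∀ i j, HasDerivAt (fun s => B s i j) (B' i j) t) (i : ι) (j : σ) :
    HasDerivAt (fun s => (A s * B s) i j) ((A' * B t + A t * B') i j) t := by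
  simp only [Matrix.add_apply, Matrix.mul_apply]
  rw [← Finset.sum_add_distrib]
  exact HasDerivAt.fun_sum fun l _ => (hA i l).mul (hB l j)

theorem norm_matrix_mul_apply_le {R : Type*} [NormedRing R] {ι κ σ : Type*} [Fintype κ]
    {A : Matrix ι κ R} {B : Matrix κ σ R} {x y : ℝ} (hx : 0 ≤ x) (hA : ∀ i j, ‖A i j‖ ≤ x)
    (hB : ∀ i j, ‖B i j‖ ≤ y) (i : ι) (j : σ) :
    ‖(A * B) i j‖ ≤ Fintype.card κ * (x * y) := by
  rw [Matrix.mul_apply]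
  refine (norm_sum_le _ _).trans ?_
  calc ∑ l, ‖A i l * B l j‖ ≤ ∑ _l : κ, x * y :=
        Finset.sum_le_sum fun l _ => (norm_mul_le _ _).trans
          (mul_le_mul (hA i l) (hB l j) (norm_nonneg _) hx)
    _ = _ := by simp

variable {d N m : ℕ}

/-! ### The derivative of `Ω_WW` along the flow -/

/-- The error of the equation satisfied by `Ω_WW`: linear in the errors `e` of the torus and `E` of
the bundle. -/
noncomputable def formErr (a : (Fin N → ℝ) → (Fin N → ℝ)) (z : Fin N → ℝ)
    (w : Matrix (Fin N) (Fin m ⊕ Fin m) ℝ) (e : Fin N → ℝ)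
    (E : Matrix (Fin N) (Fin m ⊕ Fin m) ℝ) : Matrix (Fin m ⊕ Fin m) (Fin m ⊕ Fin m) ℝ :=
  E.transpose * sympMatrix a z * w + w.transpose * sympDeriv a z e * w
    + w.transpose * sympMatrix a z * E

theorem sympDeriv_sub (a : (Fin N → ℝ) → (Fin N → ℝ)) (z u v : Fin N → ℝ) :
    sympDeriv a z (u - v) = sympDeriv a z u - sympDeriv a z v := by
  ext r s; simp [sympDeriv]

/-- Along the flow of `ω`, `∂_ω Ω_WW = -Γᵀ Ω_WW - Ω_WW Γ` up to an error that is linear in the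
invariance errors, because the Hamiltonian flow preserves `Ω`. -/
theorem hasDerivAt_omegaWW {a : (Fin N → ℝ) → (Fin N → ℝ)} {h : (Fin N → ℝ) → ℝ}
    {ω : Fin d → ℝ} {α β : Fin m → ℝ} {K : (Fin d → ℝ) → Fin N → ℝ}
    {W : (Fin d → ℝ) → Matrix (Fin N) (Fin m ⊕ Fin m) ℝ} {θ : Fin d → ℝ}
    (ha : AnalyticAt ℝ a (K θ)) (hdet : (sympMatrix a (K θ)).det ≠ 0)
    (hh : AnalyticAt ℝ h (K θ)) (hK : ∀ r, DifferentiableAt ℝ (fun t => K t r) θ)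
    (hW : ∀ r s, DifferentiableAt ℝ (fun t => W t r s) θ) (i j : Fin m ⊕ Fin m) :
    HasDerivAt (fun t : ℝ => omegaWW a K W (θ + t • ω) i j)
      ((-((Gam α β).transpose * omegaWW a K W θ + omegaWW a K W θ * Gam α β
        + formErr a (K θ) (W θ) (errK a h ω K θ) (errW a h ω α β K W θ))) i j) 0 := by
  have hline : HasDerivAt (fun t : ℝ => θ + t • ω) ω 0 := by
    simpa using ((hasDerivAt_id (0 : ℝ)).smul_const ω).const_add θ
  have along {f : (Fin d → ℝ) → ℝ} (hf : DifferentiableAt ℝ f θ) :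
      HasDerivAt (fun t : ℝ => f (θ + t • ω)) (fderiv ℝ f θ ω) 0 := by
    have h1 : HasFDerivAt f (fderiv ℝ f θ) (θ + (0 : ℝ) • ω) := by
      simpa using hf.hasFDerivAt
    exact h1.comp_hasDerivAt 0 hline
  set k' : Fin N → ℝ := hamField a h (K θ) - errK a h ω K θ with hk'
  set w' : Matrix (Fin N) (Fin m ⊕ Fin m) ℝ :=
    jacobian (hamField a h) (K θ) * W θ - W θ * Gam α β - errW a h ω α β K W θ with hw'
  have hKd (r : Fin N) : HasDerivAt (fun t : ℝ => K (θ + t • ω) r) (k' r) 0 := by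
    convert! along (hK r) using 1
    simp [hk', errK, lieDeriv]
  have hWd (r : Fin N) (s : Fin m ⊕ Fin m) :
      HasDerivAt (fun t : ℝ => W (θ + t • ω) r s) (w' r s) 0 := by
    convert! along (hW r s) using 1
    simp [hw', errW, lieDeriv]
  have hΩd (r s : Fin N) : HasDerivAt (fun t : ℝ => sympMatrix a (K (θ + t • ω)) r s)
      (sympDeriv a (K θ) k' r s) 0 := by
    have h1 : HasFDerivAt (fun y => sympMatrix a y r s)
        (fderiv ℝ (fun y => sympMatrix a y r s) (K θ)) (K (θ + (0 : ℝ) • ω)) := by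
      simpa using (analyticAt_sympMatrix ha r s).differentiableAt.hasFDerivAt
    exact h1.comp_hasDerivAt 0 (hasDerivAt_pi.2 hKd)
  have key := hasDerivAt_matrix_mul (hasDerivAt_matrix_mul
    (A := fun t : ℝ => (W (θ + t • ω)).transpose) (A' := w'.transpose)
    (fun i j => hWd j i) hΩd) hWd i j
  simp only [zero_smul, add_zero] at key
  convert! key using 1
  have hham := lieDerivative_sympMatrix ha hdet hh
  -- the terms `Wᵀ (Jᵀ Ω + ∂_X Ω + Ω J) W` cancel, with `J` the Jacobian of `X_h`
  have hX : sympDeriv a (K θ) (hamField a h (K θ))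
      = -((jacobian (hamField a h) (K θ)).transpose * sympMatrix a (K θ)
        + sympMatrix a (K θ) * jacobian (hamField a h) (K θ)) := by
    rw [eq_neg_iff_add_eq_zero, ← hham]; abel
  refine congrFun (congrFun ?_ i) j
  rw [hw', hk', sympDeriv_sub, hX, formErr, omegaWW]
  simp only [Matrix.transpose_sub, Matrix.transpose_mul, Matrix.mul_add, Matrix.add_mul,
    Matrix.mul_sub, Matrix.sub_mul, Matrix.mul_neg, Matrix.neg_mul, Matrix.mul_assoc]
  abel

/-! ### Diagonalisation of `Γ` -/

/-- The signed imaginary parts `±β` of the eigenvalues of `Γ_{α,β}`. -/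
def signedFreq (β : Fin m → ℝ) : Fin m ⊕ Fin m → ℝ := Sum.elim β (-β)

/-- The eigenvalues `α ± iβ` of `Γ_{α,β}`. -/
noncomputable def gamEigenvalue (α β : Fin m → ℝ) (b : Fin m ⊕ Fin m) : ℂ :=
  (Sum.elim α α b : ℝ) + Complex.I * (signedFreq β b : ℝ)

/-- The matrix of eigenvectors of `Γ_{α,β}`, independent of `α` and `β`. -/
noncomputable def eigenbasis (m : ℕ) : Matrix (Fin m ⊕ Fin m) (Fin m ⊕ Fin m) ℂ :=
  Matrix.fromBlocks 1 1 (-Complex.I • 1) (Complex.I • 1)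

theorem det_eigenbasis_ne_zero (m : ℕ) : (eigenbasis m).det ≠ 0 := by
  rw [eigenbasis, Matrix.det_fromBlocks_one₁₁, mul_one, ← sub_smul, Matrix.det_smul]
  simp

theorem norm_eigenbasis_le (i j : Fin m ⊕ Fin m) : ‖eigenbasis m i j‖ ≤ 1 := by
  rcases i with i | i <;> rcases j with j | j <;>
    simp [eigenbasis, Matrix.one_apply] <;> split_ifs <;> simp

theorem Gam_mul_eigenbasis (α β : Fin m → ℝ) :
    (Gam α β).map Complex.ofReal * eigenbasis m
      = eigenbasis m * Matrix.diagonal (gamEigenvalue α β) := by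
  have hd : Matrix.diagonal (gamEigenvalue α β) = Matrix.fromBlocks
      (Matrix.diagonal fun i => (α i : ℂ) + Complex.I * β i) 0 0
      (Matrix.diagonal fun i => (α i : ℂ) - Complex.I * β i) := by
    rw [Matrix.fromBlocks_diagonal]
    congr 1
    funext b
    rcases b with b | b <;> simp [gamEigenvalue, signedFreq, sub_eq_add_neg]
  rw [hd, Gam, eigenbasis, Matrix.fromBlocks_map, Matrix.fromBlocks_multiply,
    Matrix.fromBlocks_multiply]
  have hI := Complex.I_mul_I
  congr 1 <;> ext i j <;> rcases eq_or_ne i j with rfl | hij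
  all_goals first
    | simp [hij]
    | (simp; done)
    | simp; ring1
    | simp; linear_combination (β i : ℂ) * hI

/-- The real bilinear form with matrix `M` in the complex eigenbasis of `Γ`. -/
noncomputable def complexForm (M : Matrix (Fin m ⊕ Fin m) (Fin m ⊕ Fin m) ℝ) :
    Matrix (Fin m ⊕ Fin m) (Fin m ⊕ Fin m) ℂ :=
  (eigenbasis m).transpose * M.map Complex.ofReal * eigenbasis m

theorem norm_complexForm_le {M : Matrix (Fin m ⊕ Fin m) (Fin m ⊕ Fin m) ℝ} {x : ℝ}
    (hM : ∀ i j, |M i j| ≤ x) (i j : Fin m ⊕ Fin m) :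
    ‖complexForm M i j‖ ≤ ((m + m : ℕ) : ℝ) ^ 2 * x := by
  have h1 := norm_matrix_mul_apply_le (A := (eigenbasis m).transpose) (B := M.map Complex.ofReal)
    (x := 1) (y := x) zero_le_one (fun i j => norm_eigenbasis_le j i)
    (fun i j => by simpa using hM i j)
  have hx : 0 ≤ x := (abs_nonneg _).trans (hM i j)
  have h2 := norm_matrix_mul_apply_le (by positivity) h1 norm_eigenbasis_le i j
  refine h2.trans (le_of_eq ?_)
  simp only [Fintype.card_sum, Fintype.card_fin]
  ring

theorem complexForm_add (M M' : Matrix (Fin m ⊕ Fin m) (Fin m ⊕ Fin m) ℝ) :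
    complexForm (M + M') = complexForm M + complexForm M' := by
  have : (M + M').map Complex.ofReal = M.map Complex.ofReal + M'.map Complex.ofReal := by
    ext; simp
  rw [complexForm, this, Matrix.mul_add, Matrix.add_mul, complexForm, complexForm]

theorem norm_det_complexForm (M : Matrix (Fin m ⊕ Fin m) (Fin m ⊕ Fin m) ℝ) :
    ‖(complexForm M).det‖ = ‖(eigenbasis m).det‖ ^ 2 * |M.det| := by
  have : (M.map Complex.ofReal).det = ((M.det : ℝ) : ℂ) :=
    (RingHom.map_det Complex.ofRealHom M).symm
  rw [complexForm, Matrix.det_mul, Matrix.det_mul, Matrix.det_transpose, this, norm_mul, norm_mul,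
    Complex.norm_real, Real.norm_eq_abs]
  ring

theorem complexForm_apply_self {M : Matrix (Fin m ⊕ Fin m) (Fin m ⊕ Fin m) ℝ}
    (hM : M.transpose = -M) (i : Fin m ⊕ Fin m) : complexForm M i i = 0 := by
  have h : (complexForm M).transpose = -complexForm M := by
    have : (M.map Complex.ofReal).transpose = -(M.map Complex.ofReal) := by
      rw [← Matrix.transpose_map, hM]; ext; simp
    simp only [complexForm, Matrix.transpose_mul, Matrix.transpose_transpose, this,
      Matrix.neg_mul, Matrix.mul_neg, Matrix.mul_assoc]
  have := congrFun (congrFun h i) i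
  simp only [Matrix.transpose_apply, Matrix.neg_apply] at this
  exact self_eq_neg.1 this

/-- In the eigenbasis the linear operator `M ↦ Γᵀ M + M Γ` is diagonal. -/
theorem complexForm_sylvester (α β : Fin m → ℝ)
    (M : Matrix (Fin m ⊕ Fin m) (Fin m ⊕ Fin m) ℝ) (i j : Fin m ⊕ Fin m) :
    complexForm ((Gam α β).transpose * M + M * Gam α β) i j
      = (gamEigenvalue α β i + gamEigenvalue α β j) * complexForm M i j := by
  have hmul (A B : Matrix (Fin m ⊕ Fin m) (Fin m ⊕ Fin m) ℝ) :
      (A * B).map Complex.ofReal = A.map Complex.ofReal * B.map Complex.ofReal :=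
    Matrix.map_mul (f := Complex.ofRealHom)
  have hadd (A B : Matrix (Fin m ⊕ Fin m) (Fin m ⊕ Fin m) ℝ) :
      (A + B).map Complex.ofReal = A.map Complex.ofReal + B.map Complex.ofReal := by
    ext; simp
  have hG := Gam_mul_eigenbasis α β
  have hGt : (eigenbasis m).transpose * (Gam α β).transpose.map Complex.ofReal
      = Matrix.diagonal (gamEigenvalue α β) * (eigenbasis m).transpose := by
    have := congrArg Matrix.transpose hG
    rwa [Matrix.transpose_mul, Matrix.transpose_mul, Matrix.diagonal_transpose,
      ← Matrix.transpose_map] at this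
  have : complexForm ((Gam α β).transpose * M + M * Gam α β)
      = Matrix.diagonal (gamEigenvalue α β) * complexForm M
        + complexForm M * Matrix.diagonal (gamEigenvalue α β) := by
    simp only [complexForm, hmul, hadd, Matrix.mul_add, Matrix.add_mul]
    rw [← Matrix.mul_assoc (eigenbasis m).transpose, hGt]
    simp only [Matrix.mul_assoc, hG]
  rw [this, Matrix.add_apply, Matrix.diagonal_mul, Matrix.mul_diagonal]
  ring

theorem hasDerivAt_complexForm {M : ℝ → Matrix (Fin m ⊕ Fin m) (Fin m ⊕ Fin m) ℝ}
    {M' : Matrix (Fin m ⊕ Fin m) (Fin m ⊕ Fin m) ℝ} {t : ℝ}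
    (hM : ∀ i j, HasDerivAt (fun s => M s i j) (M' i j) t) (i j : Fin m ⊕ Fin m) :
    HasDerivAt (fun s => complexForm (M s) i j) (complexForm M' i j) t := by
  have h := hasDerivAt_matrix_mul (hasDerivAt_matrix_mul
    (A := fun _ : ℝ => (eigenbasis m).transpose) (A' := 0)
    (B := fun s => (M s).map Complex.ofReal) (B' := M'.map Complex.ofReal) (t := t)
    (fun i j => hasDerivAt_const _ _) (fun i j => (hM i j).ofReal_comp))
    (B := fun _ : ℝ => eigenbasis m) (B' := 0) (fun i j => hasDerivAt_const _ _) i j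
  simpa [complexForm] using h

/-- Non-resonance of the frequencies of row `j` of `Ω_WW` in the eigenbasis, except for the mode
`k = 0` paired with the conjugate eigenvector. -/
theorem DiophantineMelnikov.ne_zero {ω : Fin d → ℝ} {β : Fin m → ℝ} {γ τ : ℝ}
    (hDM : DiophantineMelnikov ω β γ τ) (j : Fin m) (k : Fin d → ℤ) (b : Fin m ⊕ Fin m)
    (hb : b ≠ Sum.inl j) (hres : ¬(b = Sum.inr j ∧ k = 0)) :
    ∑ l, (k l : ℝ) * ω l + (signedFreq β (Sum.inl j) + signedFreq β b) ≠ 0 := by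
  have hpos {k : Fin d → ℤ} (hk : k ≠ 0) : 0 < γ / (∑ l, |(k l : ℝ)|) ^ τ := by
    refine div_pos hDM.gamma_pos (Real.rpow_pos_of_pos ?_ _)
    obtain ⟨l, hl⟩ := Function.ne_iff.1 hk
    refine Finset.sum_pos' (fun _ _ => abs_nonneg _) ⟨l, Finset.mem_univ _, abs_pos.2 ?_⟩
    exact_mod_cast hl
  rcases eq_or_ne k 0 with rfl | hk
  · rcases b with l | l
    · have hlj : j ≠ l := fun e => hb (by rw [e])
      have := hDM.beta_abs_ne j l hlj
      intro h0
      simp only [signedFreq, Sum.elim_inl, Pi.zero_apply, Int.cast_zero, zero_mul,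
        Finset.sum_const_zero, zero_add] at h0
      rw [eq_neg_of_add_eq_zero_left h0, abs_neg] at this
      exact this rfl
    · have hlj : j ≠ l := fun e => hres ⟨by rw [e], rfl⟩
      have := hDM.beta_abs_ne j l hlj
      intro h0
      simp only [signedFreq, Sum.elim_inl, Sum.elim_inr, Pi.zero_apply, Int.cast_zero, zero_mul,
        Finset.sum_const_zero, zero_add, Pi.neg_apply] at h0
      exact this (by rw [eq_of_sub_eq_zero (a := β j) (b := β l) (by linarith)])
  · have hk' : -k ≠ 0 := neg_ne_zero.2 hk
    -- the conditions are imposed with `-β_j`, so they are applied to `-k` when `b` is not `inr j`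
    have hneg : ∑ l, ((-k) l : ℝ) * ω l = -∑ l, (k l : ℝ) * ω l := by
      rw [← Finset.sum_neg_distrib]
      exact Finset.sum_congr rfl fun l _ => by simp
    intro h0
    rcases b with l | l
    · have hlj : j ≠ l := fun e => hb (by rw [e])
      have h2 := (hpos hk').trans_le (hDM.melnikov_two (-k) hk' j l hlj).2
      rw [hneg] at h2
      simp only [signedFreq, Sum.elim_inl] at h0
      exact (abs_pos.1 h2) (by linarith)
    · simp only [signedFreq, Sum.elim_inl, Sum.elim_inr, Pi.neg_apply] at h0
      rcases eq_or_ne j l with rfl | hlj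
      · have h2 := (hpos hk).trans_le (hDM.diophantine k hk)
        exact (abs_pos.1 h2) (by linarith)
      · have h2 := (hpos hk').trans_le (hDM.melnikov_two (-k) hk' j l hlj).1
        rw [hneg] at h2
        exact (abs_pos.1 h2) (by linarith)

end LowDimTori

/-! ### Uniform estimates -/

namespace LowDimTori

open UnitAddTorus BoundedContinuousFunction

variable {d N m : ℕ}

/-- The pointwise form of `Ω_WW`, as a function of a point `z` and a frame `w` at `z`; frames are
plain functions so that they carry the sup norm. -/
noncomputable def frameForm (a : (Fin N → ℝ) → (Fin N → ℝ))
    (y : (Fin N → ℝ) × (Fin N → Fin m ⊕ Fin m → ℝ)) : Matrix (Fin m ⊕ Fin m) (Fin m ⊕ Fin m) ℝ :=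
  (Matrix.of y.2).transpose * sympMatrix a y.1 * Matrix.of y.2

theorem frameForm_transpose (a : (Fin N → ℝ) → (Fin N → ℝ))
    (y : (Fin N → ℝ) × (Fin N → Fin m ⊕ Fin m → ℝ)) :
    (frameForm a y).transpose = -frameForm a y := by
  simp only [frameForm, Matrix.transpose_mul, Matrix.transpose_transpose, sympMatrix_transpose,
    Matrix.neg_mul, Matrix.mul_neg, Matrix.mul_assoc]

theorem continuousOn_frameForm {a : (Fin N → ℝ) → (Fin N → ℝ)} {𝒦 : Set (Fin N → ℝ)}
    (ha : AnalyticOnNhd ℝ a 𝒦) (B : Set (Fin N → Fin m ⊕ Fin m → ℝ)) :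
    ContinuousOn (frameForm (m := m) a) (𝒦 ×ˢ B) := by
  have hΩ : ContinuousOn (fun y : (Fin N → ℝ) × (Fin N → Fin m ⊕ Fin m → ℝ) =>
      sympMatrix a y.1) (𝒦 ×ˢ B) := by
    refine continuousOn_pi.2 fun r => continuousOn_pi.2 fun s => ?_
    intro y hy
    have h1 : ContinuousAt (fun z => sympMatrix a z r s) y.1 :=
      (analyticAt_sympMatrix (ha _ hy.1) r s).continuousAt
    exact (h1.comp continuousAt_fst).continuousWithinAt
  have hw : Continuous fun y : (Fin N → ℝ) × (Fin N → Fin m ⊕ Fin m → ℝ) =>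
      (Matrix.of y.2 : Matrix (Fin N) (Fin m ⊕ Fin m) ℝ) := continuous_snd
  rw [continuousOn_iff_continuous_domRestrict] at hΩ ⊢
  have hw' := hw.comp (continuous_subtype_val (p := fun y => y ∈ 𝒦 ×ˢ B))
  exact (hw'.matrix_transpose.matrix_mul hΩ).matrix_mul hw'

theorem continuous_complexForm : Continuous (complexForm (m := m)) := by
  unfold complexForm
  exact (continuous_const.matrix_mul
    (continuous_id.matrix_map Complex.continuous_ofReal)).matrix_mul continuous_const

/-- The a priori information on a torus `K` and a bundle `W` on which the constants depend: the
compact set `𝒦`, a Lipschitz constant `L`, a bound `R` of `W` and a lower bound `c` of the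
determinant of `Ω_WW`. -/
structure BoundedPair (a : (Fin N → ℝ) → (Fin N → ℝ)) (𝒦 : Set (Fin N → ℝ)) (L R c : ℝ)
    (K : (Fin d → ℝ) → Fin N → ℝ) (W : (Fin d → ℝ) → Matrix (Fin N) (Fin m ⊕ Fin m) ℝ) :
    Prop where
  periodic_K : TorusPeriodic K
  periodic_W : TorusPeriodic W
  mem : ∀ θ, K θ ∈ 𝒦
  diff_K : ∀ r, Differentiable ℝ fun t => K t r
  diff_W : ∀ r s, Differentiable ℝ fun t => W t r s
  lip_K : ∀ r θ θ', |K θ' r - K θ r| ≤ L * ‖θ' - θ‖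
  lip_W : ∀ r s θ θ', |W θ' r s - W θ r s| ≤ L * ‖θ' - θ‖
  bound_W : ∀ θ r s, |W θ r s| ≤ R
  det_ge : ∀ θ, c ≤ |(omegaWW a K W θ).det|

section

variable {a : (Fin N → ℝ) → (Fin N → ℝ)} {𝒦 : Set (Fin N → ℝ)} {L R c : ℝ}

theorem _root_.IsCompact.exists_forall_norm_le {X ι : Type*} [TopologicalSpace X] [Finite ι]
    {E : Type*} [SeminormedAddCommGroup E] {s : Set X} (hs : IsCompact s) {f : ι → X → E}
    (hf : ∀ i, ContinuousOn (f i) s) : ∃ C, 0 ≤ C ∧ ∀ i, ∀ x ∈ s, ‖f i x‖ ≤ C := by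
  cases nonempty_fintype ι
  choose C hC using fun i => hs.exists_bound_of_continuousOn (hf i)
  refine ⟨∑ i, |C i|, Finset.sum_nonneg fun _ _ => abs_nonneg _, fun i x hx => ?_⟩
  exact ((hC i x hx).trans (le_abs_self _)).trans
    (Finset.single_le_sum (f := fun i => |C i|) (fun _ _ => abs_nonneg _) (Finset.mem_univ i))

/-- The error of the equation of `Ω_WW` is bounded by the invariance errors, uniformly over `𝒦`. -/
theorem exists_formErr_le (h𝒦 : IsCompact 𝒦) (ha : AnalyticOnNhd ℝ a 𝒦) (hR : 0 ≤ R) :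
    ∃ C, 0 ≤ C ∧ ∀ z ∈ 𝒦, ∀ (w E : Matrix (Fin N) (Fin m ⊕ Fin m) ℝ) (e : Fin N → ℝ)
      (eK eW : ℝ), 0 ≤ eK → 0 ≤ eW → (∀ r s, |w r s| ≤ R) → (∀ r, |e r| ≤ eK) →
      (∀ r s, |E r s| ≤ eW) → ∀ i j, |formErr a z w e E i j| ≤ C * (eK + eW) := by
  obtain ⟨B, hB0, hB⟩ := h𝒦.exists_forall_norm_le
    (f := fun (p : Fin N × Fin N) z => sympMatrix a z p.1 p.2)
    (fun p z hz => (analyticAt_sympMatrix (ha z hz) p.1 p.2).continuousAt.continuousWithinAt)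
  obtain ⟨B', hB'0, hB'⟩ := h𝒦.exists_forall_norm_le
    (f := fun (p : Fin N × Fin N × Fin N) z =>
      fderiv ℝ (fun y => sympMatrix a y p.1 p.2.1) z (Pi.single p.2.2 1))
    (fun p z hz => ((analyticAt_sympMatrix (ha z hz) p.1 p.2.1).fderiv_apply_const
      _).continuousAt.continuousWithinAt)
  refine ⟨2 * (N * (N * (B * R))) + N * (N * (R * (N * B')) * R), by positivity, ?_⟩
  intro z hz w E e eK eW heK heW hw he hE i j
  have hΩ (r s : Fin N) : ‖sympMatrix a z r s‖ ≤ B := hB (r, s) z hz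
  have hD (r s : Fin N) : ‖sympDeriv a z e r s‖ ≤ N * (eK * B') := by
    rw [sympDeriv, Matrix.of_apply, fderiv_apply_eq_sum]
    refine (norm_sum_le _ _).trans ?_
    calc _ ≤ ∑ _t : Fin N, eK * B' := Finset.sum_le_sum fun t _ => by
          rw [norm_mul]
          exact mul_le_mul (he t) (hB' (r, s, t) z hz) (norm_nonneg _) heK
      _ = _ := by simp
  have hEt : ∀ i r, ‖E.transpose i r‖ ≤ eW := fun i r => hE r i
  have hwt : ∀ i r, ‖w.transpose i r‖ ≤ R := fun i r => hw r i
  have t1 := norm_matrix_mul_apply_le (by positivity)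
    (norm_matrix_mul_apply_le heW hEt hΩ) (B := w) (y := R) hw i j
  have t2 := norm_matrix_mul_apply_le (by positivity)
    (norm_matrix_mul_apply_le hR hwt hD) (B := w) (y := R) hw i j
  have t3 := norm_matrix_mul_apply_le (by positivity)
    (norm_matrix_mul_apply_le hR hwt hΩ) (B := E) (y := eW) hE i j
  simp only [Fintype.card_fin] at t1 t2 t3
  rw [formErr, Matrix.add_apply, Matrix.add_apply, ← Real.norm_eq_abs]
  refine (norm_add_le _ _).trans ((add_le_add ((norm_add_le _ _).trans (add_le_add t1 t2)) t3).trans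
    ?_)
  have p1 : 0 ≤ 2 * ((N : ℝ) * (N * (B * R))) * eK := by positivity
  have p2 : 0 ≤ (N : ℝ) * (N * (R * (N * B')) * R) * eW := by positivity
  linarith

/-- A priori bound of `α`: solving the invariance equation of `W` for `W Γ`, and then for `Γ` by
means of `Ω_WW`. -/
theorem exists_abs_alpha_le {Λ : Set (Fin m → ℝ)} {h : (Fin m → ℝ) → (Fin N → ℝ) → ℝ}
    (h𝒦 : IsCompact 𝒦) (hΛ : IsCompact Λ) (ha : AnalyticOnNhd ℝ a 𝒦)
    (hdet : ∀ z ∈ 𝒦, (sympMatrix a z).det ≠ 0)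
    (hh : AnalyticOnNhd ℝ (fun p : (Fin N → ℝ) × (Fin m → ℝ) => h p.2 p.1) (𝒦 ×ˢ Λ))
    (ω : Fin d → ℝ) (β : Fin m → ℝ) (hL : 0 ≤ L) (hR : 0 ≤ R) (hc : 0 < c) :
    ∃ C, 0 ≤ C ∧ ∀ (K : (Fin d → ℝ) → Fin N → ℝ)
      (W : (Fin d → ℝ) → Matrix (Fin N) (Fin m ⊕ Fin m) ℝ) (lam α : Fin m → ℝ) (eW : ℝ),
      BoundedPair a 𝒦 L R c K W → lam ∈ Λ → 0 ≤ eW →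
      (∀ θ r s, |errW a (h lam) ω α β K W θ r s| ≤ eW) → ∀ j, |α j| ≤ C * (1 + eW) := by
  obtain ⟨B, hB0, hB⟩ := h𝒦.exists_forall_norm_le
    (f := fun (p : Fin N × Fin N) z => sympMatrix a z p.1 p.2)
    (fun p z hz => (analyticAt_sympMatrix (ha z hz) p.1 p.2).continuousAt.continuousWithinAt)
  obtain ⟨J, hJ0, hJ⟩ := (h𝒦.prod hΛ).exists_forall_norm_le
    (f := fun (p : Fin N × Fin N) (q : (Fin N → ℝ) × (Fin m → ℝ)) =>
      jacobian (hamField a (h q.2)) q.1 p.1 p.2)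
    (fun p q hq => (analyticAt_jacobian_hamField_prod (ha _ hq.1) (hdet _ hq.1) (hh q hq)
      p.1 p.2).continuousAt.continuousWithinAt)
  have hball : IsCompact (Metric.closedBall (0 : Fin N → Fin m ⊕ Fin m → ℝ) R) :=
    isCompact_closedBall _ _
  have hadj : ContinuousOn (fun y => (frameForm (m := m) a y).adjugate)
      (𝒦 ×ˢ Metric.closedBall 0 R) := by
    have := continuousOn_frameForm ha (Metric.closedBall (0 : Fin N → Fin m ⊕ Fin m → ℝ) R)
    rw [continuousOn_iff_continuous_domRestrict] at this ⊢
    exact this.matrix_adjugate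
  obtain ⟨A, hA0, hA⟩ := (h𝒦.prod hball).exists_forall_norm_le
    (f := fun (p : (Fin m ⊕ Fin m) × (Fin m ⊕ Fin m)) y =>
      (frameForm a y).adjugate p.1 p.2)
    (fun p => continuousOn_pi.1 (continuousOn_pi.1 hadj p.1) p.2)
  set Q : ℝ := N * (J * R) + L * ‖ω‖ + 1 with hQ
  have hQ0 : 0 ≤ Q := by positivity
  refine ⟨((m + m : ℕ) : ℝ) * (A * (N * (N * (R * B) * Q))) / c, by positivity, ?_⟩
  intro K W lam α eW hKW hlam heW hE j
  have hM := hKW.det_ge 0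
  set M := omegaWW a K W 0 with hMdef
  have hwd (r : Fin N) (s : Fin m ⊕ Fin m) :
      |lieDeriv ω (fun t => W t r s) 0| ≤ L * ‖ω‖ := by
    have hf : ‖fderiv ℝ (fun t => W t r s) 0‖ ≤ L := by
      refine norm_fderiv_le_of_lip' ℝ hL (Filter.Eventually.of_forall fun θ => ?_)
      exact hKW.lip_W r s 0 θ
    rw [lieDeriv, abs_neg, ← Real.norm_eq_abs]
    exact (ContinuousLinearMap.le_opNorm _ _).trans
      (mul_le_mul_of_nonneg_right hf (norm_nonneg _))
  have hWG (r : Fin N) (s : Fin m ⊕ Fin m) : ‖(W 0 * Gam α β) r s‖ ≤ Q * (1 + eW) := by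
    have hJW := norm_matrix_mul_apply_le (A := jacobian (hamField a (h lam)) (K 0)) (B := W 0)
      hJ0 (fun i j => hJ (i, j) (K 0, lam) ⟨hKW.mem 0, hlam⟩) (hKW.bound_W 0) r s
    rw [Fintype.card_fin, Real.norm_eq_abs] at hJW
    have e1 : (W 0 * Gam α β) r s = lieDeriv ω (fun t => W t r s) 0
        + (jacobian (hamField a (h lam)) (K 0) * W 0) r s
        - errW a (h lam) ω α β K W 0 r s := by
      simp [errW]
    have h1 := abs_le.1 (hwd r s)
    have h2 := abs_le.1 hJW
    have h3 := abs_le.1 (hE 0 r s)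
    have hp : 0 ≤ ((N : ℝ) * (J * R) + L * ‖ω‖) * eW := by positivity
    rw [e1, Real.norm_eq_abs, abs_le]
    constructor <;> nlinarith
  have hWt : ∀ i r, ‖(W 0).transpose i r‖ ≤ R := fun i r => hKW.bound_W 0 r i
  have hMG := norm_matrix_mul_apply_le (by positivity)
    (norm_matrix_mul_apply_le hR hWt
      fun r s => hB (r, s) (K 0) (hKW.mem 0)) hWG
  have hAdj (i i' : Fin m ⊕ Fin m) : ‖M.adjugate i i'‖ ≤ A := by
    refine hA (i, i') (K 0, fun r s => W 0 r s) ⟨hKW.mem 0, ?_⟩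
    rw [mem_closedBall_zero_iff]
    exact (pi_norm_le_iff_of_nonneg hR).2 fun r =>
      (pi_norm_le_iff_of_nonneg hR).2 fun s => hKW.bound_W 0 r s
  have hfin := norm_matrix_mul_apply_le hA0 hAdj hMG (Sum.inl j) (Sum.inl j)
  -- `Wᵀ Ω (W Γ) = Ω_WW Γ`, and the adjugate removes `Ω_WW` without dividing by its determinant
  have e2 : M.adjugate * ((W 0).transpose * sympMatrix a (K 0) * (W 0 * Gam α β))
      = M.det • Gam α β := by
    rw [← Matrix.mul_assoc ((W 0).transpose * sympMatrix a (K 0)), ← Matrix.mul_assoc]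
    change M.adjugate * M * Gam α β = _
    rw [Matrix.adjugate_mul, Matrix.smul_mul, Matrix.one_mul]
  have e3 : (M.det • Gam α β) (Sum.inl j) (Sum.inl j) = M.det * α j := by
    simp [Gam]
  rw [e2, e3, norm_mul, Real.norm_eq_abs, Real.norm_eq_abs] at hfin
  simp only [Fintype.card_sum, Fintype.card_fin] at hfin
  rw [div_mul_eq_mul_div, le_div_iff₀ hc]
  calc |α j| * c ≤ |M.det| * |α j| := by
        rw [mul_comm]; exact mul_le_mul_of_nonneg_right hM (abs_nonneg _)
    _ ≤ _ := hfin
    _ = _ := by ring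

/-- The a priori information on `(K, W)` bounds from below, uniformly, some Fourier coefficient in
row `j` of `Ω_WW` in the eigenbasis, weighted with its frequency. -/
theorem exists_lt_torusCoeff_of_boundedPair (h𝒦 : IsCompact 𝒦) (ha : AnalyticOnNhd ℝ a 𝒦)
    (hR : 0 ≤ R) (hL : 0 ≤ L) (hc : 0 < c) (j : Fin m)
    {w : (Fin d → ℤ) → Fin m ⊕ Fin m → ℝ} (hw : ∀ k b, b ≠ Sum.inl j → 0 < w k b) :
    ∃ κ > 0, ∀ (K : (Fin d → ℝ) → Fin N → ℝ)
      (W : (Fin d → ℝ) → Matrix (Fin N) (Fin m ⊕ Fin m) ℝ), BoundedPair a 𝒦 L R c K W →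
      ∃ (g : Fin m ⊕ Fin m → C(UnitAddTorus (Fin d), ℂ)) (k : Fin d → ℤ) (b : Fin m ⊕ Fin m),
        (∀ b θ, g b (torusMap θ) = complexForm (omegaWW a K W θ) (Sum.inl j) b) ∧
        b ≠ Sum.inl j ∧ κ < w k b * ‖torusCoeff (g b) k‖ := by
  set Z : Set ((Fin N → ℝ) × (Fin N → Fin m ⊕ Fin m → ℝ)) := 𝒦 ×ˢ Metric.closedBall 0 R with hZ
  have hZc : IsCompact Z := h𝒦.prod (isCompact_closedBall _ _)
  let Φ : (Fin N → ℝ) × (Fin N → Fin m ⊕ Fin m → ℝ) → Fin m ⊕ Fin m → Fin m ⊕ Fin m → ℂ :=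
    fun y i j => complexForm (frameForm a y) i j
  have hΦ : ContinuousOn Φ Z :=
    continuous_complexForm.comp_continuousOn (continuousOn_frameForm ha _)
  let A : Set (UnitAddTorus (Fin d) →ᵇ (Fin m ⊕ Fin m → Fin m ⊕ Fin m → ℂ)) :=
    {f | ∃ (K : (Fin d → ℝ) → Fin N → ℝ) (W : (Fin d → ℝ) → Matrix (Fin N) (Fin m ⊕ Fin m) ℝ),
      BoundedPair a 𝒦 L R c K W ∧ ∀ θ, f (torusMap θ) = Φ (K θ, fun r s => W θ r s)}
  have hmemZ {K : (Fin d → ℝ) → Fin N → ℝ} {W : (Fin d → ℝ) → Matrix (Fin N) (Fin m ⊕ Fin m) ℝ}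
      (hKW : BoundedPair a 𝒦 L R c K W) (θ : Fin d → ℝ) : (K θ, fun r s => W θ r s) ∈ Z := by
    refine ⟨hKW.mem θ, ?_⟩
    rw [mem_closedBall_zero_iff]
    exact (pi_norm_le_iff_of_nonneg hR).2 fun r =>
      (pi_norm_le_iff_of_nonneg hR).2 fun s => hKW.bound_W θ r s
  have hA : IsCompact (closure A) := by
    refine (isCompact_closure_lipschitz_comp hZc hΦ L).of_isClosed_subset isClosed_closure
      (closure_mono ?_)
    rintro f ⟨K, W, hKW, hf⟩
    refine ⟨fun θ => (K θ, fun r s => W θ r s), hmemZ hKW, fun θ θ' => ?_, hf⟩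
    have hnn : 0 ≤ L * dist θ θ' := mul_nonneg hL dist_nonneg
    rw [Prod.dist_eq, max_le_iff]
    constructor
    · refine (dist_pi_le_iff hnn).2 fun r => ?_
      rw [Real.dist_eq, dist_eq_norm]
      exact hKW.lip_K r θ' θ
    · refine (dist_pi_le_iff hnn).2 fun r => (dist_pi_le_iff hnn).2 fun s => ?_
      rw [Real.dist_eq, dist_eq_norm]
      exact hKW.lip_W r s θ' θ
  have hP : 0 < ‖(eigenbasis m).det‖ ^ 2 := by
    have := det_eigenbasis_ne_zero m
    positivity
  obtain ⟨κ, hκ, h⟩ := exists_lt_mul_torusCoeff hA (mul_pos hP hc) (by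
      rintro f ⟨K, W, hKW, hf⟩ x
      obtain ⟨θ, rfl⟩ := isOpenQuotientMap_torusMap.surjective x
      rw [hf]
      change _ ≤ ‖(complexForm (omegaWW a K W θ)).det‖
      rw [norm_det_complexForm]
      exact mul_le_mul_of_nonneg_left (hKW.det_ge θ) hP.le) (Sum.inl j) (by
      rintro f ⟨K, W, hKW, hf⟩ x
      obtain ⟨θ, rfl⟩ := isOpenQuotientMap_torusMap.surjective x
      rw [hf]
      exact complexForm_apply_self (frameForm_transpose a _) _) hw
  refine ⟨κ, hκ, fun K W hKW => ?_⟩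
  have hcont : Continuous fun θ => Φ (K θ, fun r s => W θ r s) := by
    refine hΦ.comp_continuous ?_ (hmemZ hKW)
    refine Continuous.prodMk (continuous_pi fun r => (hKW.diff_K r).continuous) ?_
    exact continuous_pi fun r => continuous_pi fun s => (hKW.diff_W r s).continuous
  have hper : TorusPeriodic fun θ => Φ (K θ, fun r s => W θ r s) := fun θ k => by
    simp only [hKW.periodic_K θ k, hKW.periodic_W θ k]
  obtain ⟨f, hf⟩ := hper.exists_lift hcont
  obtain ⟨k, b, hb, hlt⟩ := h (mkOfCompact f) ⟨K, W, hKW, hf⟩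
  refine ⟨fun b => ⟨fun x => f x (Sum.inl j) b, by fun_prop⟩, k, b, fun b θ => ?_, hb, hlt⟩
  change f (torusMap θ) (Sum.inl j) b = _
  rw [hf]
  rfl

/-- The estimate of `α` by the sup norms of the invariance errors on the real torus. -/
theorem exists_abs_alpha_le_err {Λ : Set (Fin m → ℝ)} {h : (Fin m → ℝ) → (Fin N → ℝ) → ℝ}
    (h𝒦 : IsCompact 𝒦) (hΛ : IsCompact Λ) (ha : AnalyticOnNhd ℝ a 𝒦)
    (hdet : ∀ z ∈ 𝒦, (sympMatrix a z).det ≠ 0)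
    (hh : AnalyticOnNhd ℝ (fun p : (Fin N → ℝ) × (Fin m → ℝ) => h p.2 p.1) (𝒦 ×ˢ Λ))
    {ω : Fin d → ℝ} {β : Fin m → ℝ} {γ τ : ℝ} (hDM : DiophantineMelnikov ω β γ τ)
    (hL : 0 ≤ L) (hR : 0 ≤ R) (hc : 0 < c) (j : Fin m) :
    ∃ C, 0 ≤ C ∧ ∀ (K : (Fin d → ℝ) → Fin N → ℝ)
      (W : (Fin d → ℝ) → Matrix (Fin N) (Fin m ⊕ Fin m) ℝ) (lam α : Fin m → ℝ) (eK eW : ℝ),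
      BoundedPair a 𝒦 L R c K W → lam ∈ Λ → 0 ≤ eK → 0 ≤ eW →
      (∀ θ r, |errK a (h lam) ω K θ r| ≤ eK) →
      (∀ θ r s, |errW a (h lam) ω α β K W θ r s| ≤ eW) → |α j| ≤ C * (eK + eW) := by
  classical
  obtain ⟨C₀, hC₀, hform⟩ := exists_formErr_le (m := m) h𝒦 ha hR
  obtain ⟨C₁, hC₁, hprior⟩ := exists_abs_alpha_le h𝒦 hΛ ha hdet hh ω β hL hR hc
  set w : (Fin d → ℤ) → Fin m ⊕ Fin m → ℝ := fun k b =>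
    if b = Sum.inr j ∧ k = 0 then 1
    else |∑ l, (k l : ℝ) * ω l + (signedFreq β (Sum.inl j) + signedFreq β b)| with hw
  have hwpos : ∀ k b, b ≠ Sum.inl j → 0 < w k b := by
    intro k b hb
    simp only [hw]
    split_ifs with hres
    · exact one_pos
    · exact abs_pos.2 (hDM.ne_zero j k b hb hres)
  obtain ⟨κ, hκ, hcoeff⟩ := exists_lt_torusCoeff_of_boundedPair (L := L) (c := c) h𝒦 ha hR hL hc j
    hwpos
  set C₂ : ℝ := ((m + m : ℕ) : ℝ) ^ 2 * C₀ with hC₂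
  have hC₂0 : 0 ≤ C₂ := by positivity
  refine ⟨C₂ / κ + C₁ * (C₂ / κ + 1), by positivity, ?_⟩
  intro K W lam α eK eW hKW hlam heK heW hEK hEW
  obtain ⟨g, k, b, hg, hb, hlt⟩ := hcoeff K W hKW
  have hode := norm_mul_torusCoeff_le (g b) ω
    (gamEigenvalue α β (Sum.inl j) + gamEigenvalue α β b) (ε := C₂ * (eK + eW)) (fun θ => by
      have hd := hasDerivAt_complexForm (hasDerivAt_omegaWW (h := h lam) (ω := ω) (α := α) (β := β)
        (ha _ (hKW.mem θ)) (hdet _ (hKW.mem θ))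
        ((hh (K θ, lam) ⟨hKW.mem θ, hlam⟩).curry_left) (fun r => hKW.diff_K r θ)
        (fun r s => hKW.diff_W r s θ)) (Sum.inl j) b
      refine ⟨_, by simpa only [hg] using hd, ?_⟩
      rw [hg, ← complexForm_sylvester, ← Matrix.add_apply, ← complexForm_add]
      have e : ∀ X Y : Matrix (Fin m ⊕ Fin m) (Fin m ⊕ Fin m) ℝ, -(X + Y) + X = -Y :=
        fun X Y => by abel
      rw [e]
      have hS := hform (K θ) (hKW.mem θ) (W θ) (errW a (h lam) ω α β K W θ)
        (errK a (h lam) ω K θ) eK eW heK heW (hKW.bound_W θ) (hEK θ) (hEW θ)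
      refine (norm_complexForm_le (x := C₀ * (eK + eW)) (fun i j => ?_) _ _).trans (le_of_eq ?_)
      · rw [Matrix.neg_apply, abs_neg]; exact hS i j
      · rw [hC₂]; ring) k
  have hsum : 0 ≤ eK + eW := add_nonneg heK heW
  by_cases hres : b = Sum.inr j ∧ k = 0
  · -- the mean value of the pairing of the two conjugate eigenvectors: the factor is `2 α_j`
    obtain ⟨rfl, rfl⟩ := hres
    have hμ : Complex.I * ((∑ l, ((0 : Fin d → ℤ) l : ℝ) * ω l : ℝ) : ℂ)
        + (gamEigenvalue α β (Sum.inl j) + gamEigenvalue α β (Sum.inr j))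
          = ((2 * α j : ℝ) : ℂ) := by
      simp [gamEigenvalue, signedFreq]; ring
    rw [hμ, Complex.norm_real, Real.norm_eq_abs, abs_mul, abs_two] at hode
    simp only [hw, and_self, if_true, one_mul] at hlt
    have h1 : |α j| * κ ≤ C₂ * (eK + eW) := by
      have := mul_le_mul_of_nonneg_left hlt.le (abs_nonneg (α j))
      nlinarith [abs_nonneg (α j), norm_nonneg (torusCoeff (g (Sum.inr j)) 0)]
    have h2 : |α j| ≤ C₂ / κ * (eK + eW) := by
      rw [div_mul_eq_mul_div, le_div_iff₀ hκ]; exact h1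
    have h3 : 0 ≤ C₁ * (C₂ / κ + 1) * (eK + eW) := by positivity
    linarith
  · -- a non-resonant mode: the errors are at least a constant, and the a priori bound is enough
    simp only [hw, if_neg hres] at hlt
    have him : |∑ l, (k l : ℝ) * ω l + (signedFreq β (Sum.inl j) + signedFreq β b)|
        ≤ ‖Complex.I * ((∑ l, (k l : ℝ) * ω l : ℝ) : ℂ)
          + (gamEigenvalue α β (Sum.inl j) + gamEigenvalue α β b)‖ := by
      refine le_trans (le_of_eq ?_) (Complex.abs_im_le_norm _)
      simp [gamEigenvalue]
    have h1 : κ ≤ C₂ * (eK + eW) :=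
      hlt.le.trans ((mul_le_mul_of_nonneg_right him (norm_nonneg _)).trans hode)
    have h2 : 1 ≤ C₂ / κ * (eK + eW) := by
      rw [div_mul_eq_mul_div, le_div_iff₀ hκ]; linarith
    have h3 := hprior K W lam α eW hKW hlam heW hEW j
    have h4 : C₁ * (1 + eW) ≤ C₁ * (C₂ / κ + 1) * (eK + eW) := by
      rw [mul_assoc]
      refine mul_le_mul_of_nonneg_left ?_ hC₁
      linarith
    have h5 : 0 ≤ C₂ / κ * (eK + eW) := by positivity
    linarith

end

end LowDimTori

theorem mainTheorem2 (n d : ℕ) (hdn : d < n)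
    (U : Set (Fin (2 * n) → ℝ)) (hU : IsOpen U)
    (a : (Fin (2 * n) → ℝ) → (Fin (2 * n) → ℝ)) (ha : AnalyticOnNhd ℝ a U)
    (hdet : ∀ z ∈ U, (sympMatrix a z).det ≠ 0)
    (V : Set (Fin (n - d) → ℝ)) (hV : IsOpen V)
    (h : (Fin (n - d) → ℝ) → (Fin (2 * n) → ℝ) → ℝ)
    (hh : AnalyticOnNhd ℝ
      (fun p : (Fin (2 * n) → ℝ) × (Fin (n - d) → ℝ) => h p.2 p.1) (U ×ˢ V))
    (ω : Fin d → ℝ) (β : Fin (n - d) → ℝ) (γ τ : ℝ) (hDM : DiophantineMelnikov ω β γ τ) :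
    (∀ (𝒦 : Set (Fin (2 * n) → ℝ)) (Λ : Set (Fin (n - d) → ℝ)),
      IsCompact 𝒦 → 𝒦 ⊆ U → IsCompact Λ → Λ ⊆ V →
      ∀ (ρ : ℝ) (R : ℝ≥0) (c : ℝ), 0 < ρ → 0 < c →
      ∃ C : ℝ≥0,
        ∀ (K : (Fin d → ℝ) → Fin (2 * n) → ℝ)
          (W : (Fin d → ℝ) → Matrix (Fin (2 * n)) (Fin (n - d) ⊕ Fin (n - d)) ℝ)
          (lam α : Fin (n - d) → ℝ),
          TorusPeriodic K → TorusPeriodic W →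
          (∀ θ, K θ ∈ 𝒦) → lam ∈ Λ →
          stripNormVec ρ K ≤ R → stripNorm ρ W ≤ R →
          (∀ θ, c ≤ |(omegaWW a K W θ).det|) →
          ∀ δ : ℝ, 0 < δ →
            ‖α‖ₑ ≤ C * (stripNormVec δ (errK a (h lam) ω K)
              + stripNorm δ (errW a (h lam) ω α β K W)))
    ∧
    (∀ (K : (Fin d → ℝ) → Fin (2 * n) → ℝ)
        (W : (Fin d → ℝ) → Matrix (Fin (2 * n)) (Fin (n - d) ⊕ Fin (n - d)) ℝ)
        (lam α : Fin (n - d) → ℝ) (ρ : ℝ), 0 < ρ →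
        TorusPeriodic K → TorusPeriodic W →
        (∀ θ, K θ ∈ U) → lam ∈ V →
        stripNormVec ρ K < ∞ → stripNorm ρ W < ∞ →
        (∀ θ, (omegaWW a K W θ).det ≠ 0) →
        (∀ θ, errK a (h lam) ω K θ = 0) → (∀ θ, errW a (h lam) ω α β K W θ = 0) →
        α = 0) := by
  have bound : ∀ (𝒦 : Set (Fin (2 * n) → ℝ)) (Λ : Set (Fin (n - d) → ℝ)),
      IsCompact 𝒦 → 𝒦 ⊆ U → IsCompact Λ → Λ ⊆ V →
      ∀ (ρ : ℝ) (R : ℝ≥0) (c : ℝ), 0 < ρ → 0 < c →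
      ∃ C : ℝ, 0 ≤ C ∧
        ∀ (K : (Fin d → ℝ) → Fin (2 * n) → ℝ)
          (W : (Fin d → ℝ) → Matrix (Fin (2 * n)) (Fin (n - d) ⊕ Fin (n - d)) ℝ)
          (lam α : Fin (n - d) → ℝ) (eK eW : ℝ),
          TorusPeriodic K → TorusPeriodic W →
          (∀ θ, K θ ∈ 𝒦) → lam ∈ Λ →
          stripNormVec ρ K ≤ R → stripNorm ρ W ≤ R →
          (∀ θ, c ≤ |(omegaWW a K W θ).det|) → 0 ≤ eK → 0 ≤ eW →
          (∀ θ r, |errK a (h lam) ω K θ r| ≤ eK) →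
          (∀ θ r s, |errW a (h lam) ω α β K W θ r s| ≤ eW) → ‖α‖ ≤ C * (eK + eW) := by
    intro 𝒦 Λ h𝒦 h𝒦U hΛ hΛV ρ R c hρ hc
    set L : ℝ := 2 * ((R : ℝ) + 1) / ρ with hL
    have hL0 : 0 ≤ L := by positivity
    choose C hC0 hC using exists_abs_alpha_le_err h𝒦 hΛ (ha.mono h𝒦U)
      (fun z hz => hdet z (h𝒦U hz)) (hh.mono (Set.prod_mono h𝒦U hΛV)) hDM hL0 R.2 hc
    have hCs : 0 ≤ ∑ j, C j := Finset.sum_nonneg fun j _ => hC0 j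
    refine ⟨∑ j, C j, hCs, ?_⟩
    intro K W lam α eK eW hKp hWp hK𝒦 hlam hKρ hWρ hdetc heK heW hEK hEW
    have hKW : BoundedPair a 𝒦 L R c K W :=
      ⟨hKp, hWp, hK𝒦, fun r => differentiable_of_stripNorm_le hρ hKρ r (),
        fun r s => differentiable_of_stripNorm_le hρ hWρ r s,
        fun r => lipschitz_of_stripNorm_le hρ hKρ r (),
        fun r s => lipschitz_of_stripNorm_le hρ hWρ r s,
        fun θ r s => abs_le_of_stripNorm_le hρ hWρ θ r s, hdetc⟩
    have he : 0 ≤ eK + eW := add_nonneg heK heW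
    refine (pi_norm_le_iff_of_nonneg (mul_nonneg hCs he)).2 fun j => ?_
    refine (hC j K W lam α eK eW hKW hlam heK heW hEK hEW).trans ?_
    exact mul_le_mul_of_nonneg_right
      (Finset.single_le_sum (fun j _ => hC0 j) (Finset.mem_univ j)) he
  refine ⟨?_, ?_⟩
  · intro 𝒦 Λ h𝒦 h𝒦U hΛ hΛV ρ R c hρ hc
    obtain ⟨C, hC0, hC⟩ := bound 𝒦 Λ h𝒦 h𝒦U hΛ hΛV ρ R c hρ hc
    -- adding `1` makes the right-hand side infinite when a norm of the errors is
    lift C to ℝ≥0 using hC0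
    refine ⟨C + 1, ?_⟩
    intro K W lam α hKp hWp hK𝒦 hlam hKρ hWρ hdetc δ hδ
    rcases eq_or_ne (stripNormVec δ (errK a (h lam) ω K)
        + stripNorm δ (errW a (h lam) ω α β K W)) ∞ with htop | hfin
    · rw [htop, ENNReal.mul_top
        (ENNReal.coe_ne_zero.2 (add_pos_of_nonneg_of_pos zero_le one_pos).ne')]
      exact le_top
    obtain ⟨hK, hW⟩ := ENNReal.add_ne_top.1 hfin
    lift stripNormVec δ (errK a (h lam) ω K) to ℝ≥0 using hK with eK heK
    lift stripNorm δ (errW a (h lam) ω α β K W) to ℝ≥0 using hW with eW heW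
    have hb := hC K W lam α eK eW hKp hWp hK𝒦 hlam hKρ hWρ hdetc eK.2 eW.2
      (fun θ r => abs_le_of_stripNorm_le hδ heK.ge θ r ())
      (fun θ r s => abs_le_of_stripNorm_le hδ heW.ge θ r s)
    have hb' : ‖α‖₊ ≤ (C + 1) * (eK + eW) := by
      rw [← NNReal.coe_le_coe]
      push_cast
      have : (0 : ℝ) ≤ eK + eW := by positivity
      linarith
    rw [enorm_eq_nnnorm]
    exact_mod_cast hb'
  · intro K W lam α ρ hρ hKp hWp hKU hlam hKρ hWρ hdet0 hEK hEW
    set R : ℝ≥0 := (stripNormVec ρ K).toNNReal + (stripNorm ρ W).toNNReal with hR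
    have hKR : stripNormVec ρ K ≤ R := by
      rw [hR, ENNReal.coe_add, ENNReal.coe_toNNReal hKρ.ne]; exact le_self_add
    have hWR : stripNorm ρ W ≤ R := by
      rw [hR, ENNReal.coe_add, ENNReal.coe_toNNReal hWρ.ne]; exact le_add_self
    have hKc : Continuous K :=
      continuous_pi fun r => (differentiable_of_stripNorm_le hρ hKR r ()).continuous
    have hWc : Continuous W := continuous_pi fun r => continuous_pi fun s =>
      (differentiable_of_stripNorm_le hρ hWR r s).continuous
    have hΩc : Continuous fun θ => sympMatrix a (K θ) := by
      refine continuous_pi fun r => continuous_pi fun s => ?_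
      refine continuous_iff_continuousAt.2 fun θ => ?_
      have h1 : ContinuousAt (fun z => sympMatrix a z r s) (K θ) :=
        (analyticAt_sympMatrix (ha _ (hKU θ)) r s).continuousAt
      exact h1.comp hKc.continuousAt
    have hdc : Continuous fun θ => (omegaWW a K W θ).det :=
      ((hWc.matrix_transpose.matrix_mul hΩc).matrix_mul hWc).matrix_det
    have hdp : TorusPeriodic fun θ => (omegaWW a K W θ).det := fun θ k => by
      simp only [omegaWW, hKp θ k, hWp θ k]
    -- compactness of the torus provides `𝒦 = K(𝕋ᵈ)` and the lower bound of the determinant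
    obtain ⟨gK, hgK⟩ := hKp.exists_lift hKc
    obtain ⟨gD, hgD⟩ := hdp.exists_lift hdc
    obtain ⟨x₀, -, hx₀⟩ := isCompact_univ.exists_isMinOn Set.univ_nonempty
      (f := fun x => |gD x|) (by fun_prop)
    have hsurj := (isOpenQuotientMap_torusMap (d := d)).surjective
    have hc : 0 < |gD x₀| := by
      obtain ⟨θ, rfl⟩ := hsurj x₀
      rw [hgD]
      exact abs_pos.2 (hdet0 θ)
    obtain ⟨C, -, hC⟩ := bound (Set.range gK) {lam} (isCompact_range gK.continuous)
      (by
        rintro _ ⟨x, rfl⟩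
        obtain ⟨θ, rfl⟩ := hsurj x
        rw [hgK]; exact hKU θ)
      isCompact_singleton (by simpa using hlam) ρ R _ hρ hc
    have := hC K W lam α 0 0 hKp hWp (fun θ => ⟨torusMap θ, hgK θ⟩) rfl hKR hWR
      (fun θ => by rw [← hgD]; exact hx₀ (Set.mem_univ _)) le_rfl le_rfl
      (fun θ r => by rw [hEK]; simp) (fun θ r s => by rw [hEW]; simp)
    simpa using this
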